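/- Throughout, $\log$ is the principal logarithm ($-\pi<\operatorname{Im}\log w\le\pi$), $\arg=\operatorname{Im}\log$, and complex powers are principal, $w^s=e^{s\log w}$ for $w\neq 0$ (with $0^0=1$, and $0^s=0$ for $s\ne0$); $\log^k(ax^2)$ means $(\log(ax^2))^k$. The Lerch function is $$\Phi(z,s,v)=\sum_{j=0}^{\infty}(v+j)^{-s}z^{j}\qquad(|z|<1),$$ continued analytically in $z$ to $\mathbb{C}\setminus[1,\infty)$ (principal branch); if the continuation is also analytic at a point $z\in(1,\infty)$ (for instance if $-s$ is a nonnegative integer, when it is a rational function of $z$), $\Phi(z,s,v)$ denotes its value there. **Theorem.** Let $m,n,a,k,l\in\mathbb{C}$ with $\operatorname{Re} l>0$, $a\neq0$, $$0<\operatorname{Re}(2n+1)<2\operatorname{Re} l,\qquad 0<\operatorname{Re}(2m+1)<2\operatorname{Re} l .$$ Assume that either (i) $k$ is a nonnegative integer, or (ii) $0<\arg a\le\pi$, or $a>0$ and $\operatorname{Re}k>-1$; and moreover, for each $p\in\{n,m\}$, either $\operatorname{Im}\frac{2p+1}{l}>0$ (that is, $|e^{i\pi(2p+1)/l}|<1$)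 or $0<\operatorname{Re}\frac{2p+1}{l}<2$. (The last condition in (ii) holds automatically if $l$ is real.) Then the integral below converges absolutely and $$\int_{0}^{\infty}\frac{(x^{2n}-x^{2m})\log^k(ax^2)}{x^{2l}-1}\,dx=\frac{i2^k\pi^{k+1}\left(\frac{i}{l}\right)^k e^{\frac{i(2\pi n+\pi)}{l}}}{l}\,\Phi\!\left(e^{\frac{i(2n+1)\pi}{l}},-k,1-\frac{il\log a}{2\pi}\right)-\frac{i2^k\pi^{k+1}\left(\frac{i}{l}\right)^k e^{\frac{i(2\pi m+\pi)}{l}}}{l}\,\Phi\!\left(e^{\frac{i(2m+1)\pi}{l}},-k,1-\frac{il\log a}{2\pi}\right).$$ -/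

import Mathlib

noncomputable section

/-- The series `∑ j, (v + j) ^ (-s) * z ^ j` of the Lerch function (principal powers). -/
def lerchSeries (z s v : ℂ) : ℂ := ∑' j : ℕ, (v + (j : ℂ)) ^ (-s) * z ^ j

/-- The cut plane `ℂ \ [1, ∞)`, the domain in `z` of the principal branch. -/
def lerchDomain : Set ℂ := {w : ℂ | 1 - w ∈ Complex.slitPlane}

/-- `f` continues the Lerch series analytically from the unit disc to `ℂ \ [1, ∞)`, and is
analytic also at `z`.  The latter is a condition only if `z` lies on the cut: there it can hold
with `z ≠ 1` when the continuation has no branching, e.g. when `-s` is a natural number and the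
continuation is a rational function. -/
def IsLerchContinuation (f : ℂ → ℂ) (z s v : ℂ) : Prop :=
  AnalyticOnNhd ℂ f (insert z lerchDomain) ∧ ∀ w : ℂ, ‖w‖ < 1 → f w = lerchSeries w s v

open Classical in
/-- The Lerch function `Φ(z, s, v)`, principal branch in `z`: the sum of the series for `|z| < 1`
(and at `z = 1`, where it is the Hurwitz series), and its analytic continuation to `ℂ \ [1, ∞)`
elsewhere. -/
def lerchPhi (z s v : ℂ) : ℂ :=
  if ‖z‖ < 1 ∨ z = 1 then lerchSeries z s v
  else if h : ∃ f : ℂ → ℂ, IsLerchContinuation f z s v then h.choose z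
  else 0

/-- The continuation is unique, so `lerchPhi` does not depend on the choice made. -/
theorem IsLerchContinuation.lerchPhi_eq {f : ℂ → ℂ} {z s v : ℂ}
    (hf : IsLerchContinuation f z s v) (hz : z ≠ 1) : lerchPhi z s v = f z := by
  classical
  unfold lerchPhi
  by_cases h1 : ‖z‖ < 1
  · rw [if_pos (Or.inl h1), hf.2 z h1]
  · have h : ∃ f : ℂ → ℂ, IsLerchContinuation f z s v := ⟨f, hf⟩
    rw [if_neg (by tauto), dif_pos h]
    have hD : IsPreconnected lerchDomain := by
      have h2 : IsPreconnected Complex.slitPlane :=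
        (Complex.starConvex_one_slitPlane.isPathConnected
          Complex.one_mem_slitPlane).isConnected.isPreconnected
      have h3 : lerchDomain = (fun w : ℂ => 1 - w) '' Complex.slitPlane := by
        ext w
        constructor
        · intro hw
          exact ⟨1 - w, hw, by simp⟩
        · rintro ⟨y, hy, rfl⟩
          simpa [lerchDomain] using hy
      rw [h3]
      exact h2.image _ (by fun_prop)
    have hcl : z ∈ closure lerchDomain := by
      by_cases hzD : z ∈ lerchDomain
      · exact subset_closure hzD
      · have him : z.im = 0 := by
          by_contra hne
          apply hzD
          right
          simpa using hne
        refine mem_closure_of_tendsto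
          (f := fun n : ℕ => z + ((1 / ((n : ℝ) + 1) : ℝ) : ℂ) * Complex.I)
          (b := Filter.atTop) ?_ (Filter.Eventually.of_forall ?_)
        · have h4 : Filter.Tendsto (fun n : ℕ => ((1 / ((n : ℝ) + 1) : ℝ) : ℂ))
              Filter.atTop (nhds ((0 : ℝ) : ℂ)) :=
            (Complex.continuous_ofReal.tendsto 0).comp tendsto_one_div_add_atTop_nhds_zero_nat
          simpa using (h4.mul_const Complex.I).const_add z
        · intro n
          right
          have h5 : (0 : ℝ) < 1 / ((n : ℝ) + 1) := by positivity
          have h6 : (1 - (z + ((1 / ((n : ℝ) + 1) : ℝ) : ℂ) * Complex.I)).im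
              = -(1 / ((n : ℝ) + 1)) := by
            rw [Complex.sub_im, Complex.add_im, Complex.im_ofReal_mul, him]
            simp
          rw [h6]
          linarith
    have hI : IsPreconnected (insert z lerchDomain) :=
      hD.subset_closure (Set.subset_insert _ _) (Set.insert_subset hcl subset_closure)
    have h0 : (0 : ℂ) ∈ insert z lerchDomain := by
      right
      simp [lerchDomain]
    refine h.choose_spec.1.eqOn_of_preconnected_of_eventuallyEq hf.1 hI h0 ?_
      (Set.mem_insert _ _)
    filter_upwards [Metric.ball_mem_nhds (0 : ℂ) one_pos] with w hw
    have hw' : ‖w‖ < 1 := by simpa using hw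
    rw [h.choose_spec.2 w hw', hf.2 w hw']

/-- The base points at which the closed form selects the principal branch of `Φ`: with
`z = exp (iπ(2n+1)/l)`, either `|z| < 1` (first alternative) or `iπ(2n+1)/l` is the logarithm
of `z` with imaginary part in `(0, 2π)`. -/
def OnPrincipalBranch (n l : ℂ) : Prop :=
  0 < ((2 * n + 1) / l).im ∨ (0 < ((2 * n + 1) / l).re ∧ ((2 * n + 1) / l).re < 2)

end

/-!
The substitution `x = e^{u/2}` turns the integral into one half of
`∫ kern l A B u * (L + u) ^ k du` over the real line, where `A = n + 1/2`, `B = m + 1/2`,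
`L = log a` and `kern l A B u = (e^{Au} - e^{Bu}) / (e^{lu} - 1)`.  Closing the contour in the upper
half plane suggests the value `θ ∑_{j ≥ 1} (L + θ j) ^ k (e^{θAj} - e^{θBj})` with `θ = 2πi / l`,
the spacing of the poles (`period l`); up to the factor `θ ^ k` these are two Lerch series.  The
proof reaches this value without contour integrals.

* For `k = 0` (`integral_kern`), expanding `1 / (e^{lu} - 1)` geometrically on the two half-lines
  gives the partial fractions of the cotangent.  This holds for all `A`, `B` in the strip
  `0 < Re < Re l`, hence also after multiplication of the kernel by a character `e^{iut}`.
* For `Re k < 0` and `Im L > 0` (`residueFormula_of_re_neg`), `(L + u) ^ k` is a Mellin integral of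
  `e^{i(L+u)t}`, so that Fubini reduces the claim to the case `k = 0`; a geometric expansion then
  produces the Mellin integrals of the coefficients `(L + θ j) ^ k`.
* Since `∂/∂A` multiplies `e^{Au}` by `u`, the operator `L + ∂/∂A + ∂/∂B` raises `k` by one on
  both sides (`ResidueFormula.add_one`).  This gives every `k` if `Im L > 0`, and every natural `k`
  for arbitrary `L`.  Real `L` with `Re k > -1` is the limit of `L + iε` as `ε → 0`
  (`residueFormula_ofReal`).

At this point the formula is known where both series converge, that is for `|e^{θA}| < 1` and
`|e^{θB}| < 1`.  The Lerch series has an analytic continuation to `ℂ \ {1}` if `k` is a natural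
number and to `ℂ \ [1, ∞)` in general (`continues_natCast`, `continues_lerchDomain`); the integral
is analytic in `A` on the strip.  The identity theorem, applied on the whole strip or on a connected
part of it that `A ↦ e^{θA}` maps into the cut plane (`branchStrip`), extends the formula to all
admitted exponents (`integral_kern_eq_of_continuation`).
-/

namespace LerchIntegral

open Complex MeasureTheory Filter Topology Set

/-! ### The kernel and its exponential decay -/

/-- The kernel `(e^{Au} - e^{Bu}) / (e^{lu} - 1)`, to which the substitution `x = e^{u/2}` reduces
the rational factor of the integrand.  At `u = 0` it takes the junk value `0`, which is harmless
since it is only ever integrated. -/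
noncomputable def kern (l A B : ℂ) (u : ℝ) : ℂ := (exp (A * u) - exp (B * u)) / (exp (l * u) - 1)

/-- The derivative of `kern l A B u` with respect to `A`. -/
noncomputable def dkern (l A : ℂ) (u : ℝ) : ℂ := u * exp (A * u) / (exp (l * u) - 1)

lemma norm_exp_mul_ofReal (A : ℂ) (u : ℝ) : ‖exp (A * u)‖ = Real.exp (A.re * u) := by
  rw [norm_exp]; simp

lemma abs_exp_sub_one_le (l : ℂ) (u : ℝ) :
    |Real.exp (l.re * u) - 1| ≤ ‖exp (l * u) - 1‖ := by
  have := abs_norm_sub_norm_le (exp (l * u)) 1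
  rwa [norm_exp_mul_ofReal, norm_one] at this

lemma exp_mul_sub_one_ne_zero {l : ℂ} (hl : 0 < l.re) {u : ℝ} (hu : u ≠ 0) :
    exp (l * u) - 1 ≠ 0 := by
  have h1 : Real.exp (l.re * u) ≠ 1 := by
    rw [Ne, Real.exp_eq_one_iff]
    exact mul_ne_zero hl.ne' hu
  have h2 := abs_exp_sub_one_le l u
  have h3 : 0 < |Real.exp (l.re * u) - 1| := abs_pos.mpr (sub_ne_zero.mpr h1)
  exact norm_pos_iff.mp (h3.trans_le h2)

/-- The linear factor from the zero of the denominator costs only a linear weight: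
`|x| / |e^x - 1| ≤ (1 + |x|) min(1, e^{-x})`. -/
lemma abs_mul_exp_div_le {lam a d u : ℝ} (hlam : 0 < lam) (h1 : d ≤ a)
    (h2 : d ≤ lam - a) :
    |u| * Real.exp (a * u) ≤
      (1 / lam + |u|) * Real.exp (-(d * |u|)) * |Real.exp (lam * u) - 1| := by
  have key : ∀ x : ℝ, 0 ≤ x → x ≤ (1 + x) * (1 - Real.exp (-x)) := by
    intro x hx
    have h3 : (1 + x) * Real.exp (-x) ≤ 1 := by
      have h4 := Real.add_one_le_exp x
      calc (1 + x) * Real.exp (-x) ≤ Real.exp x * Real.exp (-x) := by gcongr; linarith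
        _ = 1 := by rw [← Real.exp_add]; simp
    linarith
  rcases le_total 0 u with hu | hu
  · have hx : 0 ≤ lam * u := by positivity
    have h5 := key _ hx
    rw [abs_of_nonneg hu, abs_of_nonneg (by linarith [Real.add_one_le_exp (lam * u)])]
    have h6 : Real.exp (lam * u) - 1 = Real.exp (lam * u) * (1 - Real.exp (-(lam * u))) := by
      rw [mul_sub, ← Real.exp_add]; simp
    have h7 : u ≤ (1 / lam + u) * (1 - Real.exp (-(lam * u))) := by
      have : lam * u ≤ lam * ((1 / lam + u) * (1 - Real.exp (-(lam * u)))) := by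
        rw [← mul_assoc, mul_add, mul_one_div_cancel hlam.ne']; exact h5
      exact le_of_mul_le_mul_left this hlam
    have h8 : Real.exp (a * u) ≤ Real.exp (-(d * u)) * Real.exp (lam * u) := by
      rw [← Real.exp_add]
      apply Real.exp_le_exp.mpr
      nlinarith
    rw [h6]
    calc u * Real.exp (a * u)
        ≤ ((1 / lam + u) * (1 - Real.exp (-(lam * u)))) *
          (Real.exp (-(d * u)) * Real.exp (lam * u)) :=
          mul_le_mul h7 h8 (Real.exp_pos _).le (hu.trans h7)
      _ = _ := by ring
  · have hx : 0 ≤ lam * (-u) := mul_nonneg hlam.le (by linarith)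
    have h5 := key _ hx
    have h6 : Real.exp (lam * u) ≤ 1 := Real.exp_le_one_iff.mpr (by linarith)
    rw [abs_of_nonpos hu, abs_of_nonpos (by linarith), neg_sub]
    have h7 : -u ≤ (1 / lam + -u) * (1 - Real.exp (lam * u)) := by
      have : lam * (-u) ≤ lam * ((1 / lam + -u) * (1 - Real.exp (lam * u))) := by
        rw [← mul_assoc, mul_add, mul_one_div_cancel hlam.ne']
        convert h5 using 4
        ring
      exact le_of_mul_le_mul_left this hlam
    have h8 : Real.exp (a * u) ≤ Real.exp (-(d * -u)) := by
      apply Real.exp_le_exp.mpr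
      nlinarith
    calc -u * Real.exp (a * u)
        ≤ ((1 / lam + -u) * (1 - Real.exp (lam * u))) * Real.exp (-(d * -u)) :=
          mul_le_mul h7 h8 (Real.exp_pos _).le (le_trans (by linarith) h7)
      _ = _ := by ring

lemma add_abs_mul_exp_le {c d : ℝ} (hc : 0 ≤ c) (hd : 0 < d) (u : ℝ) :
    (c + |u|) * Real.exp (-(d * |u|)) ≤ (c + 2 / d) * Real.exp (-(d / 2 * |u|)) := by
  have h1 : |u| ≤ 2 / d * Real.exp (d / 2 * |u|) := by
    have h2 := Real.add_one_le_exp (d / 2 * |u|)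
    calc |u| = 2 / d * (d / 2 * |u|) := by field_simp
      _ ≤ _ := by gcongr; linarith
  have h3 : c ≤ c * Real.exp (d / 2 * |u|) :=
    le_mul_of_one_le_right hc (Real.one_le_exp (by positivity))
  have h4 : Real.exp (-(d * |u|)) = Real.exp (-(d / 2 * |u|)) * Real.exp (-(d / 2 * |u|)) := by
    rw [← Real.exp_add]; ring_nf
  have h5 : Real.exp (d / 2 * |u|) * Real.exp (-(d / 2 * |u|)) = 1 := by
    rw [← Real.exp_add]; simp
  calc (c + |u|) * Real.exp (-(d * |u|))
      ≤ ((c + 2 / d) * Real.exp (d / 2 * |u|)) * Real.exp (-(d * |u|)) := by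
        gcongr; linarith
    _ = (c + 2 / d) * (Real.exp (d / 2 * |u|) * Real.exp (-(d / 2 * |u|)))
          * Real.exp (-(d / 2 * |u|)) := by rw [h4]; ring
    _ = _ := by rw [h5, mul_one]

lemma norm_dkern_le {l A : ℂ} (hl : 0 < l.re) {d : ℝ} (hd : 0 < d)
    (h1 : d ≤ A.re) (h2 : d ≤ l.re - A.re) (u : ℝ) :
    ‖dkern l A u‖ ≤ (1 / l.re + 2 / d) * Real.exp (-(d / 2 * |u|)) := by
  refine le_trans ?_ (add_abs_mul_exp_le (by positivity) hd u)
  rw [dkern, norm_div, norm_mul, norm_exp_mul_ofReal, norm_real, Real.norm_eq_abs]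
  refine div_le_of_le_mul₀ (norm_nonneg _) (by positivity) ?_
  refine (abs_mul_exp_div_le hl h1 h2).trans ?_
  gcongr
  exact abs_exp_sub_one_le l u

lemma hasDerivAt_kern (l A B : ℂ) (u : ℝ) :
    HasDerivAt (fun X => kern l X B u) (dkern l A u) A := by
  have h : HasDerivAt (fun X : ℂ => exp (X * u)) (exp (A * u) * (1 * u)) A :=
    ((hasDerivAt_id A).mul_const (u : ℂ)).cexp
  have h1 : dkern l A u = exp (A * u) * (1 * u) / (exp (l * u) - 1) := by rw [dkern]; ring
  rw [h1]
  exact (h.sub_const (exp (B * u))).div_const (exp (l * u) - 1)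

/-- The mean value inequality in `A` turns the bound on `dkern` into one on `kern`. -/
lemma norm_kern_le {l A B : ℂ} (hl : 0 < l.re) {d : ℝ} (hd : 0 < d)
    (hA : d ≤ A.re) (hA' : d ≤ l.re - A.re) (hB : d ≤ B.re) (hB' : d ≤ l.re - B.re) (u : ℝ) :
    ‖kern l A B u‖ ≤
      (1 / l.re + 2 / d) * Real.exp (-(d / 2 * |u|)) * ‖A - B‖ := by
  have hconv : Convex ℝ {X : ℂ | d ≤ X.re ∧ X.re ≤ l.re - d} :=
    (convex_halfSpace_re_ge d).inter (convex_halfSpace_re_le (l.re - d))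
  have h := hconv.norm_image_sub_le_of_norm_hasDerivWithin_le
    (f := fun X => kern l X B u) (f' := fun X => dkern l X u)
    (C := (1 / l.re + 2 / d) * Real.exp (-(d / 2 * |u|)))
    (x := B) (y := A)
    (fun X _ => (hasDerivAt_kern l X B u).hasDerivWithinAt)
    (fun X hX => norm_dkern_le hl hd hX.1 (by linarith [hX.2]) u)
    ⟨hB, by linarith⟩ ⟨hA, by linarith⟩
  simpa [kern] using h

lemma measurable_kern (l A B : ℂ) : Measurable (kern l A B) := by
  unfold kern
  fun_prop

lemma measurable_dkern (l A : ℂ) : Measurable (dkern l A) := by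
  unfold dkern
  fun_prop

/-- The open strip `0 < Re A < Re l` of exponents for which the integrals converge. -/
def strip (l : ℂ) : Set ℂ := {A | 0 < A.re ∧ A.re < l.re}

lemma isOpen_strip (l : ℂ) : IsOpen (strip l) :=
  (isOpen_lt continuous_const continuous_re).inter (isOpen_lt continuous_re continuous_const)

lemma convex_strip (l : ℂ) : Convex ℝ (strip l) :=
  (convex_halfSpace_re_gt 0).inter (convex_halfSpace_re_lt l.re)

/-- Two exponents in the strip have a common positive distance `d` from its edges. -/
lemma exists_margin {l A B : ℂ} (hA : A ∈ strip l) (hB : B ∈ strip l) :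
    ∃ d, 0 < d ∧ d ≤ A.re ∧ d ≤ l.re - A.re ∧ d ≤ B.re ∧ d ≤ l.re - B.re := by
  refine ⟨min (min A.re (l.re - A.re)) (min B.re (l.re - B.re)), ?_, ?_, ?_, ?_, ?_⟩
  · have := hA.1; have := hA.2; have := hB.1; have := hB.2
    simp only [lt_min_iff]
    refine ⟨⟨?_, ?_⟩, ?_, ?_⟩ <;> linarith
  all_goals simp

/-- Weights `w` that are integrable against every decaying exponential `e^{-d|u|}`. -/
def Tempered (w : ℝ → ℂ) : Prop :=
  ∀ d : ℝ, 0 < d → Integrable (fun u : ℝ => w u * (Real.exp (-(d * |u|)) : ℂ))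

lemma Tempered.aestronglyMeasurable {w : ℝ → ℂ} (hw : Tempered w) :
    AEStronglyMeasurable w := by
  have h := (hw 1 one_pos).aestronglyMeasurable.mul
    (f := fun u : ℝ => w u * (Real.exp (-(1 * |u|)) : ℂ))
    (g := fun u : ℝ => (Real.exp |u| : ℂ)) (by fun_prop)
  refine h.congr (ae_of_all _ fun u => ?_)
  simp only [Pi.mul_apply, mul_assoc, ← ofReal_mul, ← Real.exp_add]
  simp

lemma Tempered.integrable_mul {w g : ℝ → ℂ} (hw : Tempered w) (hg : Measurable g) {C d : ℝ}
    (hd : 0 < d) (hgb : ∀ u, ‖g u‖ ≤ C * Real.exp (-(d * |u|))) :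
    Integrable (fun u => g u * w u) := by
  refine ((hw d hd).norm.const_mul C).mono' (hg.aestronglyMeasurable.mul
    hw.aestronglyMeasurable) (ae_of_all _ fun u => ?_)
  rw [norm_mul, norm_mul, norm_real, Real.norm_eq_abs, Real.abs_exp]
  calc ‖g u‖ * ‖w u‖ ≤ C * Real.exp (-(d * |u|)) * ‖w u‖ := by gcongr; exact hgb u
    _ = _ := by ring

lemma Tempered.integrable_kern {w : ℝ → ℂ} (hw : Tempered w) {l A B : ℂ} (hl : 0 < l.re)
    (hA : A ∈ strip l) (hB : B ∈ strip l) : Integrable (fun u => kern l A B u * w u) := by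
  obtain ⟨d, hd, h1, h2, h3, h4⟩ := exists_margin hA hB
  refine hw.integrable_mul (measurable_kern l A B) (C := (1 / l.re + 2 / d) * ‖A - B‖)
    (half_pos hd) fun u => ?_
  refine (norm_kern_le hl hd h1 h2 h3 h4 u).trans_eq (by ring)

lemma Tempered.integrable_dkern {w : ℝ → ℂ} (hw : Tempered w) {l A : ℂ} (hl : 0 < l.re)
    (hA : A ∈ strip l) : Integrable (fun u => dkern l A u * w u) := by
  obtain ⟨d, hd, h1, h2, -⟩ := exists_margin hA hA
  exact hw.integrable_mul (measurable_dkern l A) (half_pos hd)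
    (norm_dkern_le hl hd h1 h2)

lemma Tempered.hasDerivAt_integral_kern {w : ℝ → ℂ} (hw : Tempered w) {l A B : ℂ}
    (hl : 0 < l.re) (hA : A ∈ strip l) (hB : B ∈ strip l) :
    HasDerivAt (fun X => ∫ u, kern l X B u * w u) (∫ u, dkern l A u * w u) A := by
  obtain ⟨d, hd, h1, h2, -⟩ := exists_margin hA hA
  have hs : {X : ℂ | d / 2 < X.re ∧ X.re < l.re - d / 2} ∈ 𝓝 A := by
    refine ((isOpen_lt continuous_const continuous_re).inter
      (isOpen_lt continuous_re continuous_const)).mem_nhds ⟨?_, ?_⟩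
    · change d / 2 < A.re; linarith
    · change A.re < l.re - d / 2; linarith
  refine (hasDerivAt_integral_of_dominated_loc_of_deriv_le (μ := volume)
    (F := fun X u => kern l X B u * w u) (F' := fun X u => dkern l X u * w u)
    (bound := fun u => (1 / l.re + 2 / (d / 2)) *
      ‖w u * (Real.exp (-(d / 2 / 2 * |u|)) : ℂ)‖)
    hs ?_ (hw.integrable_kern hl hA hB) ?_ ?_ ?_ ?_).2
  · exact Eventually.of_forall fun X =>
      (measurable_kern l X B).aestronglyMeasurable.mul hw.aestronglyMeasurable
  · exact (measurable_dkern l A).aestronglyMeasurable.mul hw.aestronglyMeasurable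
  · refine ae_of_all _ fun u X hX => ?_
    rw [norm_mul, norm_mul, norm_real, Real.norm_eq_abs, Real.abs_exp]
    have := norm_dkern_le hl (half_pos hd) hX.1.le (by linarith [hX.2]) u
    calc ‖dkern l X u‖ * ‖w u‖ ≤ _ := mul_le_mul_of_nonneg_right this (norm_nonneg _)
      _ = _ := by ring
  · exact (hw _ (by positivity)).norm.const_mul _
  · exact ae_of_all _ fun u X _ => (hasDerivAt_kern l X B u).mul_const (w u)

lemma Tempered.mul_linear {w : ℝ → ℂ} (hw : Tempered w) (L : ℂ) :
    Tempered (fun u => w u * (L + u)) := by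
  intro d hd
  have h := hw.integrable_mul (g := fun u : ℝ => (L + u) * (Real.exp (-(d * |u|)) : ℂ))
    (by fun_prop) (C := ‖L‖ + 2 / d) (half_pos hd) fun u => ?_
  · exact h.congr (ae_of_all _ fun u => by ring)
  · rw [norm_mul, norm_real, Real.norm_eq_abs, Real.abs_exp]
    refine le_trans ?_ (add_abs_mul_exp_le (norm_nonneg L) hd u)
    gcongr
    exact (norm_add_le _ _).trans (by simp)

lemma integrable_exp_neg_mul_abs {d : ℝ} (hd : 0 < d) :
    Integrable (fun u : ℝ => Real.exp (-(d * |u|))) := by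
  have h : Integrable ((Ioi (0 : ℝ)).indicator fun u => Real.exp (-d * u)) :=
    (integrable_indicator_iff measurableSet_Ioi).mpr (exp_neg_integrableOn_Ioi 0 hd)
  refine (h.add h.comp_neg).mono' (by fun_prop) ?_
  have h0 : ∀ᵐ u : ℝ, u ≠ 0 := by
    simp [ae_iff]
  filter_upwards [h0] with u hu
  rw [Real.norm_eq_abs, Real.abs_exp]
  rcases lt_or_gt_of_ne hu with h | h
  · simp [indicator, h, h.not_gt, abs_of_neg h]
  · simp [indicator, h, h.not_gt, abs_of_pos h]

lemma tempered_of_bounded {w : ℝ → ℂ} (hw : AEStronglyMeasurable w) {C : ℝ}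
    (hC : ∀ u, ‖w u‖ ≤ C) : Tempered w := by
  intro d hd
  refine ((integrable_exp_neg_mul_abs hd).const_mul C).mono' (hw.mul (by fun_prop))
    (ae_of_all _ fun u => ?_)
  rw [norm_mul, norm_real, Real.norm_eq_abs, Real.abs_exp]
  gcongr
  exact hC u

/-! ### The integral of the kernel -/

/-- The spacing `2πi / l` of the poles of `1 / (e^{lu} - 1)`. -/
noncomputable def period (l : ℂ) : ℂ := 2 * Real.pi * I / l

lemma tempered_one : Tempered (fun _ => 1) :=
  tempered_of_bounded aestronglyMeasurable_const (C := 1) (by simp)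

lemma integrable_kern {l A B : ℂ} (hl : 0 < l.re) (hA : A ∈ strip l) (hB : B ∈ strip l) :
    Integrable (kern l A B) := by
  simpa using tempered_one.integrable_kern hl hA hB

lemma ne_zero_of_re_pos {l : ℂ} (hl : 0 < l.re) : l ≠ 0 := by
  rintro rfl; simp at hl

/-- The exponential `e^{2πiA/l}` is `1` only at the integer multiples of `l`, none of which lies in
the open strip. -/
lemma exp_period_mul_ne_one {l A : ℂ} (hl : 0 < l.re) (hA : A ∈ strip l) :
    exp (period l * A) ≠ 1 := by
  intro h
  obtain ⟨j, hj⟩ := exp_eq_one_iff.mp h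
  have hl0 := ne_zero_of_re_pos hl
  have h1 : A = j * l := by
    have h2 : period l * A = (2 * Real.pi * I) * (A / l) := by rw [period]; ring
    rw [h2, mul_comm] at hj
    have h3 := mul_right_cancel₀ two_pi_I_ne_zero hj
    rw [← h3, div_mul_cancel₀ _ hl0]
  have h4 : A.re = j * l.re := by rw [h1, ← ofReal_intCast, re_ofReal_mul]
  have h5 := hA.1
  have h6 := hA.2
  rw [h4] at h5 h6
  have h7 : (0 : ℝ) < j := pos_of_mul_pos_left h5 hl.le
  have h8 : (j : ℝ) < 1 := by nlinarith
  have h9 : 0 < j := by exact_mod_cast h7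
  have h10 : j < 1 := by exact_mod_cast h8
  omega

lemma div_mem_integerComplement {l A : ℂ} (hl : 0 < l.re) (hA : A ∈ strip l) :
    A / l ∈ integerComplement := by
  rintro ⟨j, hj⟩
  apply exp_period_mul_ne_one hl hA
  rw [show period l * A = (A / l) * (2 * Real.pi * I) by rw [period]; ring, ← hj]
  exact exp_int_mul_two_pi_mul_I j

/-- One step of the geometric expansion of `1 / (e^{lu} - 1)` on the positive half-line. -/
lemma integral_Ioi_kern_mul_exp_succ {l A B : ℂ} (hl : 0 < l.re) (hA : A ∈ strip l)
    (hB : B ∈ strip l) (J : ℕ) :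
    (∫ u in Ioi (0 : ℝ), kern l A B u * exp (-(l * u)) ^ J) =
      (∫ u in Ioi (0 : ℝ), kern l A B u * exp (-(l * u)) ^ (J + 1)) +
        (1 / ((J + 1) * l - A) - 1 / ((J + 1) * l - B)) := by
  have hint : ∀ J : ℕ, IntegrableOn (fun u : ℝ => kern l A B u * exp (-(l * u)) ^ J) (Ioi 0) := by
    intro J
    refine (integrable_kern hl hA hB).integrableOn.norm.mono'
      ((measurable_kern l A B).mul (by fun_prop)).aestronglyMeasurable ?_
    filter_upwards [ae_restrict_mem measurableSet_Ioi] with u hu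
    rw [norm_mul, norm_pow, ← neg_mul, norm_exp_mul_ofReal]
    refine mul_le_of_le_one_right (norm_nonneg _) (pow_le_one₀ (Real.exp_pos _).le ?_)
    rw [Real.exp_le_one_iff]
    simp only [neg_re, neg_mul, Left.neg_nonpos_iff]
    exact mul_nonneg hl.le (le_of_lt hu)
  have hexp : ∀ X ∈ strip l, (X - (J + 1) * l).re < 0 := by
    intro X hX
    have h1 : ((J + 1) * l : ℂ).re = (J + 1) * l.re := by
      rw [← ofReal_natCast, ← ofReal_one, ← ofReal_add, re_ofReal_mul]
    rw [sub_re, h1]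
    have := hX.2
    nlinarith [mul_nonneg (Nat.cast_nonneg (α := ℝ) J) hl.le]
  have hval : ∀ X ∈ strip l, ∫ u in Ioi (0 : ℝ), exp ((X - (J + 1) * l) * u) =
      1 / ((J + 1) * l - X) := by
    intro X hX
    rw [integral_exp_mul_complex_Ioi (hexp X hX)]
    simp only [ofReal_zero, mul_zero, Complex.exp_zero]
    rw [← neg_sub ((J + 1) * l) X, div_neg, neg_div, neg_neg]
  rw [← sub_eq_iff_eq_add', ← integral_sub (hint J) (hint (J + 1)), ← hval A hA, ← hval B hB,
    ← integral_sub (integrableOn_exp_mul_complex_Ioi (hexp A hA) 0)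
      (integrableOn_exp_mul_complex_Ioi (hexp B hB) 0)]
  refine setIntegral_congr_fun measurableSet_Ioi fun u hu => ?_
  have hne := exp_mul_sub_one_ne_zero hl (ne_of_gt hu : u ≠ 0)
  have e1 : ∀ X : ℂ, exp ((X - (J + 1) * l) * u) = exp (X * u) * exp (-(l * u)) ^ (J + 1) := by
    intro X
    rw [← exp_nat_mul, ← exp_add]
    congr 1
    push_cast
    ring
  have e2 : exp (-(l * u)) ^ J = exp (l * u) * exp (-(l * u)) ^ (J + 1) := by
    rw [pow_succ', ← mul_assoc, ← exp_add]; simp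
  simp only [e1, e2, kern]
  generalize exp (l * u) = E at hne ⊢
  field_simp

/-- One step of the geometric expansion of `1 / (e^{lu} - 1)` on the negative half-line. -/
lemma integral_Iio_kern_mul_exp_succ {l A B : ℂ} (hl : 0 < l.re) (hA : A ∈ strip l)
    (hB : B ∈ strip l) (J : ℕ) :
    (∫ u in Iio (0 : ℝ), kern l A B u * exp (l * u) ^ J) =
      (∫ u in Iio (0 : ℝ), kern l A B u * exp (l * u) ^ (J + 1)) -
        (1 / (A + J * l) - 1 / (B + J * l)) := by
  have hint : ∀ J : ℕ, IntegrableOn (fun u : ℝ => kern l A B u * exp (l * u) ^ J) (Iio 0) := by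
    intro J
    refine (integrable_kern hl hA hB).integrableOn.norm.mono'
      ((measurable_kern l A B).mul (by fun_prop)).aestronglyMeasurable ?_
    filter_upwards [ae_restrict_mem measurableSet_Iio] with u hu
    rw [norm_mul, norm_pow, norm_exp_mul_ofReal]
    refine mul_le_of_le_one_right (norm_nonneg _) (pow_le_one₀ (Real.exp_pos _).le ?_)
    rw [Real.exp_le_one_iff]
    exact mul_nonpos_of_nonneg_of_nonpos hl.le (le_of_lt hu)
  have hexp : ∀ X ∈ strip l, 0 < (X + J * l).re := by
    intro X hX
    have h1 : (J * l : ℂ).re = J * l.re := by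
      rw [← ofReal_natCast, re_ofReal_mul]
    rw [add_re, h1]
    have := hX.1
    positivity
  have hval : ∀ X ∈ strip l, ∫ u in Iio (0 : ℝ), exp ((X + J * l) * u) =
      1 / (X + J * l) := by
    intro X hX
    rw [← integral_Iic_eq_integral_Iio, integral_exp_mul_complex_Iic (hexp X hX)]
    simp
  rw [sub_eq_add_neg, ← sub_eq_iff_eq_add', ← integral_sub (hint J) (hint (J + 1)), ← hval A hA,
    ← hval B hB,
    ← integral_sub ((integrableOn_exp_mul_complex_Iic (hexp A hA) 0).mono_set Iio_subset_Iic_self)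
      ((integrableOn_exp_mul_complex_Iic (hexp B hB) 0).mono_set Iio_subset_Iic_self),
    ← integral_neg]
  refine setIntegral_congr_fun measurableSet_Iio fun u hu => ?_
  have hne := exp_mul_sub_one_ne_zero hl (ne_of_lt hu : u ≠ 0)
  have e1 : ∀ X : ℂ, exp ((X + J * l) * u) = exp (X * u) * exp (l * u) ^ J := by
    intro X
    rw [← exp_nat_mul, ← exp_add]
    congr 1
    ring
  simp only [e1, pow_succ, kern]
  generalize exp (l * u) = E at hne ⊢
  field_simp
  ring

/-- The remainder of a geometric expansion of the kernel tends to `0`. -/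
lemma tendsto_setIntegral_kern_mul_pow {l A B : ℂ} (hl : 0 < l.re) (hA : A ∈ strip l)
    (hB : B ∈ strip l) {s : Set ℝ} (hs : MeasurableSet s) {g : ℝ → ℂ} (hg : Measurable g)
    (hg1 : ∀ u ∈ s, ‖g u‖ < 1) :
    Tendsto (fun J : ℕ => ∫ u in s, kern l A B u * g u ^ J) atTop (𝓝 0) := by
  rw [← integral_zero ℝ ℂ (μ := volume.restrict s)]
  refine tendsto_integral_of_dominated_convergence (fun u => ‖kern l A B u‖)
    (fun J => ((measurable_kern l A B).mul (hg.pow_const J)).aestronglyMeasurable)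
    (integrable_kern hl hA hB).integrableOn.norm (fun J => ?_) ?_
  · filter_upwards [ae_restrict_mem hs] with u hu
    rw [norm_mul, norm_pow]
    exact mul_le_of_le_one_right (norm_nonneg _) (pow_le_one₀ (norm_nonneg _) (hg1 u hu).le)
  · filter_upwards [ae_restrict_mem hs] with u hu
    simpa using (tendsto_pow_atTop_nhds_zero_of_norm_lt_one (hg1 u hu)).const_mul (kern l A B u)

/-- The case of weight `1`: expanding `1 / (e^{lu} - 1)` geometrically on both half-lines gives the
partial fractions of the cotangent. -/
theorem integral_kern {l A B : ℂ} (hl : 0 < l.re) (hA : A ∈ strip l) (hB : B ∈ strip l) :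
    ∫ u, kern l A B u = period l *
      (exp (period l * A) / (1 - exp (period l * A)) -
        exp (period l * B) / (1 - exp (period l * B))) := by
  have hl0 := ne_zero_of_re_pos hl
  -- `R J` is what remains of the integral after `J` terms of both expansions
  set R : ℕ → ℂ := fun J => (∫ u in Ioi (0 : ℝ), kern l A B u * exp (-(l * u)) ^ J) +
    ∫ u in Iio (0 : ℝ), kern l A B u * exp (l * u) ^ J with hR
  -- partial sums of the cotangent series; the last term appears because the expansion on the
  -- negative half-line starts at `j = 0`, the one on the positive half-line at `j = 1`
  set p : ℂ → ℕ → ℂ := fun X J =>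
    (∑ j ∈ Finset.range J, (1 / (X / l - (j + 1)) + 1 / (X / l + (j + 1)))) / l
      + 1 / X - 1 / (X + J * l) with hp
  have hR0 : R 0 = ∫ u, kern l A B u := by
    simp only [hR, pow_zero, mul_one]
    rw [← integral_Iic_eq_integral_Iio, add_comm, ← compl_Iic]
    exact integral_add_compl measurableSet_Iic (integrable_kern hl hA hB)
  have hRlim : Tendsto R atTop (𝓝 0) := by
    have h1 := tendsto_setIntegral_kern_mul_pow hl hA hB measurableSet_Ioi
      (g := fun u : ℝ => exp (-(l * u))) (by fun_prop) (fun u hu => by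
        rw [← neg_mul, norm_exp_mul_ofReal, Real.exp_lt_one_iff]
        simpa using mul_pos hl hu)
    have h2 := tendsto_setIntegral_kern_mul_pow hl hA hB measurableSet_Iio
      (g := fun u : ℝ => exp (l * u)) (by fun_prop) (fun u hu => by
        rw [norm_exp_mul_ofReal, Real.exp_lt_one_iff]
        exact mul_neg_of_pos_of_neg hl hu)
    simpa using h1.add h2
  have hstep : ∀ X ∈ strip l, ∀ J : ℕ, p X (J + 1) =
      p X J - (1 / ((J + 1) * l - X)) + 1 / (X + J * l) := by
    intro X hX J
    have hre : ∀ r : ℝ, ((r : ℂ) * l).re = r * l.re := fun r => by rw [re_ofReal_mul]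
    simp only [hp, Finset.sum_range_succ]
    have e1 : X / l - (J + 1) = -(((J + 1) * l - X) / l) := by field_simp; ring
    have e2 : X / l + (J + 1) = (X + (J + 1 : ℕ) * l) / l := by push_cast; field_simp
    rw [e1, e2, one_div_div, one_div, ← neg_inv, inv_div]
    field_simp
    ring
  have hsum : ∀ J, R J = R 0 + p A J - p B J := by
    intro J
    induction J with
    | zero => simp [hp]
    | succ J ih =>
      rw [hstep A hA, hstep B hB]
      have h1 := integral_Ioi_kern_mul_exp_succ hl hA hB J
      have h2 := integral_Iio_kern_mul_exp_succ hl hA hB J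
      simp only [hR] at ih ⊢
      linear_combination ih - h1 - h2
  have hplim : ∀ X ∈ strip l, Tendsto (p X) atTop (𝓝 (Real.pi / l *
      ((exp (period l * X) + 1) / (I * (1 - exp (period l * X)))))) := by
    intro X hX
    have h1 := tendsto_logDeriv_euler_cot_sub (div_mem_integerComplement hl hX)
    have h2 : Tendsto (fun J : ℕ => 1 / (X + J * l)) atTop (𝓝 0) := by
      simp only [one_div]
      refine tendsto_inv₀_cobounded.comp ?_
      refine tendsto_norm_atTop_iff_cobounded.mp ?_
      refine tendsto_atTop_mono (f := fun J : ℕ => (J : ℝ) * ‖l‖ - ‖X‖) (fun J => ?_) ?_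
      · have := norm_sub_norm_le (J * l) (-X)
        rw [norm_mul, norm_natCast, norm_neg, sub_neg_eq_add, add_comm] at this
        simpa [add_comm] using this
      · exact tendsto_atTop_add_const_right _ _
          (tendsto_natCast_atTop_atTop.atTop_mul_const (norm_pos_iff.mpr hl0))
    have h3 := ((h1.div_const l).add_const (1 / X)).sub h2
    rw [cot_pi_eq_exp_ratio] at h3
    have e : (2 * Real.pi * I * (X / l) : ℂ) = period l * X := by rw [period]; ring
    rw [e] at h3
    convert h3 using 2
    have hX0 : X ≠ 0 := ne_zero_of_re_pos hX.1
    field_simp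
    ring
  have hlim := ((hplim A hA).const_add (R 0)).sub (hplim B hB)
  have h0 := tendsto_nhds_unique hRlim (hlim.congr fun J => (hsum J).symm)
  rw [← hR0]
  have hA1 : 1 - exp (period l * A) ≠ 0 := sub_ne_zero.mpr (exp_period_mul_ne_one hl hA).symm
  have hB1 : 1 - exp (period l * B) ≠ 0 := sub_ne_zero.mpr (exp_period_mul_ne_one hl hB).symm
  have hper : (Real.pi / l : ℂ) = - (period l * I / 2) := by
    rw [period]
    linear_combination ((Real.pi : ℂ) / l) * I_sq
  have key : ∀ q : ℂ, 1 - q ≠ 0 → Real.pi / l * ((q + 1) / (I * (1 - q))) =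
      - (period l * (q / (1 - q))) - period l / 2 := by
    intro q hq
    rw [hper]
    field_simp
    ring
  rw [key _ hA1, key _ hB1] at h0
  linear_combination -h0

/-! ### Power series with coefficients `(c + d j) ^ k` -/

/-- The series `∑ j, (c + d j) ^ k z ^ j`.  For `c = v` and `d = 1` it is the Lerch series. -/
noncomputable def affineSeries (c d k z : ℂ) : ℂ := ∑' j : ℕ, (c + d * j) ^ k * z ^ j

lemma lerchSeries_eq_affineSeries (z s v : ℂ) : lerchSeries z s v = affineSeries v 1 (-s) z := by
  simp [lerchSeries, affineSeries]

lemma norm_cpow_le_rpow_mul (w k : ℂ) :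
    ‖w ^ k‖ ≤ ‖w‖ ^ k.re * Real.exp (Real.pi * |k.im|) := by
  refine (norm_cpow_le w k).trans ?_
  rw [div_eq_mul_inv, ← Real.exp_neg]
  gcongr
  calc -(arg w * k.im) ≤ |arg w * k.im| := neg_le_abs _
    _ = |arg w| * |k.im| := abs_mul _ _
    _ ≤ _ := by gcongr; exact abs_arg_le_pi w

lemma isBigO_affine_cpow (c k : ℂ) {d : ℂ} (hd : d ≠ 0) :
    (fun j : ℕ => (c + d * j) ^ k) =O[atTop] fun j : ℕ => ((j ^ ⌈|k.re|⌉₊ : ℕ) : ℂ) := by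
  set K := ⌈|k.re|⌉₊ with hK
  have hK' : k.re ≤ K := (le_abs_self _).trans (Nat.le_ceil _)
  have h1 : Tendsto (fun j : ℕ => ‖c + d * j‖) atTop atTop := by
    refine tendsto_atTop_mono (f := fun j : ℕ => (j : ℝ) * ‖d‖ - ‖c‖) (fun j => ?_) ?_
    · have := norm_sub_norm_le (d * j) (-c)
      rw [norm_mul, norm_natCast, norm_neg, sub_neg_eq_add, add_comm (d * _)] at this
      linarith
    · exact tendsto_atTop_add_const_right _ _
        (tendsto_natCast_atTop_atTop.atTop_mul_const (norm_pos_iff.mpr hd))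
  refine Asymptotics.IsBigO.of_bound ((‖c‖ + ‖d‖) ^ K * Real.exp (Real.pi * |k.im|)) ?_
  filter_upwards [h1.eventually_ge_atTop 1, eventually_ge_atTop 1] with j hj hj1
  have hj1' : (1 : ℝ) ≤ j := by exact_mod_cast hj1
  have h2 : ‖c + d * j‖ ≤ (‖c‖ + ‖d‖) * j := by
    refine (norm_add_le _ _).trans ?_
    rw [norm_mul, norm_natCast, add_mul]
    gcongr
    exact le_mul_of_one_le_right (norm_nonneg _) hj1'
  calc ‖(c + d * j) ^ k‖ ≤ ‖c + d * j‖ ^ k.re * Real.exp (Real.pi * |k.im|) :=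
        norm_cpow_le_rpow_mul _ _
    _ ≤ ‖c + d * j‖ ^ (K : ℝ) * Real.exp (Real.pi * |k.im|) := by
        gcongr
    _ = ‖c + d * j‖ ^ K * Real.exp (Real.pi * |k.im|) := by rw [Real.rpow_natCast]
    _ ≤ ((‖c‖ + ‖d‖) * j) ^ K * Real.exp (Real.pi * |k.im|) := by gcongr
    _ = _ := by
        rw [Nat.cast_pow, norm_pow, norm_natCast, mul_pow]
        ring

lemma summable_norm_affine (c k : ℂ) {d z : ℂ} (hd : d ≠ 0) (hz : ‖z‖ < 1) :
    Summable fun j : ℕ => ‖(c + d * j) ^ k * z ^ j‖ :=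
  summable_norm_mul_geometric_of_norm_lt_one' hz (isBigO_affine_cpow c k hd)

/-- Termwise differentiation. -/
lemma hasDerivAt_affineSeries (c k : ℂ) {d z : ℂ} (hd : d ≠ 0) (hz : ‖z‖ < 1) :
    HasDerivAt (affineSeries c d k) (∑' j : ℕ, (c + d * j) ^ k * (j * z ^ (j - 1))) z := by
  obtain ⟨r, hzr, hr1⟩ := exists_between hz
  have hr0 : 0 < r := (norm_nonneg z).trans_lt hzr
  have hsum : Summable fun j : ℕ => ‖(c + d * j) ^ k‖ * (j * r ^ (j - 1)) := by
    have hO : (fun j : ℕ => (c + d * j) ^ k * j) =O[atTop]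
        fun j : ℕ => ((j ^ (⌈|k.re|⌉₊ + 1) : ℕ) : ℂ) := by
      have := (isBigO_affine_cpow c k hd).mul
        (Asymptotics.isBigO_refl (fun j : ℕ => (j : ℂ)) atTop)
      refine this.trans (Asymptotics.IsBigO.of_bound 1 (Eventually.of_forall fun j => ?_))
      simp [pow_succ]
    have h1 := summable_norm_mul_geometric_of_norm_lt_one'
      (r := (r : ℂ)) (by simpa [abs_of_pos hr0] using hr1) hO
    refine (h1.mul_left (1 / r)).congr fun j => ?_
    rcases j with _ | j
    · simp
    · simp only [norm_mul, norm_pow, norm_real, Real.norm_eq_abs, abs_of_pos hr0, norm_natCast,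
        Nat.add_sub_cancel]
      field_simp
      ring
  refine hasDerivAt_tsum_of_isPreconnected (g := fun (j : ℕ) z => (c + d * j) ^ k * z ^ j)
    (g' := fun (j : ℕ) z => (c + d * j) ^ k * (j * z ^ (j - 1)))
    (t := Metric.ball (0 : ℂ) r) (y₀ := 0)
    hsum Metric.isOpen_ball
    (convex_ball (0 : ℂ) r).isPreconnected (fun j y _ => ?_) (fun j y hy => ?_)
    (Metric.mem_ball_self hr0) ?_ (by simpa using hzr)
  · exact (hasDerivAt_pow j y).const_mul _
  · rw [norm_mul, norm_mul, norm_pow, Complex.norm_natCast]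
    have : ‖y‖ ≤ r := by simpa using (Metric.mem_ball.mp hy).le
    gcongr
  · exact (summable_norm_affine c k hd (by simp)).of_norm

/-- The exponent of the coefficients is raised by the operator `c + d z d/dz`.  The hypothesis `h`
can fail only where the convention for powers of `0` interferes. -/
lemma affineSeries_add_one {c d k z : ℂ} (hd : d ≠ 0) (hz : ‖z‖ < 1)
    (h : ∀ j : ℕ, (c + d * j) ^ (k + 1) = (c + d * j) ^ k * (c + d * j)) :
    affineSeries c d (k + 1) z =
      c * affineSeries c d k z + d * (z * deriv (affineSeries c d k) z) := by
  rw [(hasDerivAt_affineSeries c k hd hz).deriv]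
  have h1 := (summable_norm_affine c k hd hz).of_norm
  have h2 := (summable_norm_affine c (k + 1) hd hz).of_norm
  have e : ∀ j : ℕ, d * (z * ((c + d * j) ^ k * (j * z ^ (j - 1)))) =
      (c + d * j) ^ (k + 1) * z ^ j - c * ((c + d * j) ^ k * z ^ j) := by
    intro j
    rw [h j]
    rcases j with _ | j
    · simp
      ring
    · simp only [Nat.add_sub_cancel, pow_succ]
      ring
  rw [← tsum_mul_left, ← tsum_mul_left, tsum_congr e, h2.tsum_sub (h1.mul_left c),
    tsum_mul_left]
  simp [affineSeries]

/-! ### The closed form on the region where both series converge -/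

/-- The integral formula for the weight `(L + u) ^ k`, for exponents at which the series on the
right, a sum over the residues in the upper half plane, converges. -/
def ResidueFormula (l L k : ℂ) : Prop :=
  ∀ A ∈ strip l, ∀ B ∈ strip l, (period l * A).re < 0 → (period l * B).re < 0 →
    ∫ u : ℝ, kern l A B u * (L + u) ^ k = period l *
      (exp (period l * A) * affineSeries (L + period l) (period l) k (exp (period l * A)) -
       exp (period l * B) * affineSeries (L + period l) (period l) k (exp (period l * B)))

lemma period_ne_zero {l : ℂ} (hl : 0 < l.re) : period l ≠ 0 :=
  div_ne_zero two_pi_I_ne_zero (ne_zero_of_re_pos hl)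

lemma norm_exp_lt_one {w : ℂ} (h : w.re < 0) : ‖exp w‖ < 1 := by
  rw [norm_exp, Real.exp_lt_one_iff]; exact h

/-- Raising the exponent: multiplying the weight by `L + u` amounts to applying
`L + ∂/∂A + ∂/∂B` to the integral. -/
lemma ResidueFormula.add_one {l L k : ℂ} (hl : 0 < l.re) (h : ResidueFormula l L k)
    (hw : Tempered fun u => (L + u) ^ k)
    (h1 : ∀ u : ℝ, (L + u) ^ (k + 1) = (L + u) ^ k * (L + u))
    (h2 : ∀ j : ℕ, (L + period l + period l * j) ^ (k + 1) =
      (L + period l + period l * j) ^ k * (L + period l + period l * j)) :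
    ResidueFormula l L (k + 1) := by
  have hd := period_ne_zero hl
  set S := affineSeries (L + period l) (period l) k with hS
  have hder : ∀ A ∈ strip l, (period l * A).re < 0 → ∀ B ∈ strip l, (period l * B).re < 0 →
      ∫ u, dkern l A u * (L + u) ^ k = period l * (period l * exp (period l * A) *
        (S (exp (period l * A)) + exp (period l * A) * deriv S (exp (period l * A)))) := by
    intro A hA hA1 B hB hB1
    have d1 := hw.hasDerivAt_integral_kern hl hA hB
    have d2 : HasDerivAt (fun X => exp (period l * X)) (exp (period l * A) * (period l * 1)) A :=
      ((hasDerivAt_id A).const_mul (period l)).cexp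
    have d3 : HasDerivAt S (deriv S (exp (period l * A))) (exp (period l * A)) :=
      (hasDerivAt_affineSeries _ k hd (norm_exp_lt_one hA1)).differentiableAt.hasDerivAt
    have d4 := ((d2.mul (d3.comp A d2)).sub_const
      (exp (period l * B) * S (exp (period l * B)))).const_mul (period l)
    have hev : (fun X => ∫ u : ℝ, kern l X B u * (L + u) ^ k) =ᶠ[𝓝 A]
        fun X => period l * (exp (period l * X) * S (exp (period l * X)) -
          exp (period l * B) * S (exp (period l * B))) := by
      have ho : IsOpen {X : ℂ | (period l * X).re < 0} :=
        isOpen_lt (by fun_prop) continuous_const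
      filter_upwards [(isOpen_strip l).mem_nhds hA, ho.mem_nhds hA1] with X hX hX1
      exact h X hX B hB hX1 hB1
    rw [(d1.congr_of_eventuallyEq hev.symm).unique d4]
    simp only [Function.comp]
    ring
  intro A hA B hB hA1 hB1
  have e : ∀ u : ℝ, kern l A B u * (L + u) ^ (k + 1) = L * (kern l A B u * (L + u) ^ k) +
      (dkern l A u * (L + u) ^ k - dkern l B u * (L + u) ^ k) := by
    intro u
    rw [h1]
    simp only [kern, dkern]
    ring
  simp_rw [e]
  have i1 : Integrable fun u => dkern l A u * (L + u) ^ k - dkern l B u * (L + u) ^ k :=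
    (hw.integrable_dkern hl hA).sub (hw.integrable_dkern hl hB)
  rw [integral_add ((hw.integrable_kern hl hA hB).const_mul L) i1,
    integral_sub (hw.integrable_dkern hl hA) (hw.integrable_dkern hl hB), integral_const_mul,
    hder A hA hA1 B hB hB1, hder B hB hB1 A hA hA1, h A hA B hB hA1 hB1,
    affineSeries_add_one hd (norm_exp_lt_one hA1) h2,
    affineSeries_add_one hd (norm_exp_lt_one hB1) h2]
  simp only [← hS]
  ring

/-- For `k = 0` the series is geometric. -/
lemma residueFormula_zero {l : ℂ} (hl : 0 < l.re) (L : ℂ) : ResidueFormula l L 0 := by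
  intro A hA B hB hA1 hB1
  simp only [cpow_zero, mul_one, affineSeries, one_mul]
  rw [integral_kern hl hA hB, tsum_geometric_of_norm_lt_one (norm_exp_lt_one hA1),
    tsum_geometric_of_norm_lt_one (norm_exp_lt_one hB1)]
  simp only [div_eq_mul_inv]

lemma residueFormula_natCast {l : ℂ} (hl : 0 < l.re) (L : ℂ) (N : ℕ) :
    Tempered (fun u => (L + u) ^ (N : ℂ)) ∧ ResidueFormula l L N := by
  have e : ∀ (N : ℕ) (w : ℂ), w ^ ((N : ℂ) + 1) = w ^ (N : ℂ) * w := by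
    intro N w
    rw [← Nat.cast_succ, cpow_natCast, cpow_natCast, pow_succ]
  induction N with
  | zero =>
    simp only [Nat.cast_zero, cpow_zero]
    exact ⟨tempered_one, residueFormula_zero hl L⟩
  | succ N ih =>
    rw [Nat.cast_succ]
    simp_rw [e]
    exact ⟨ih.1.mul_linear L, ih.2.add_one hl ih.1 (fun _ => e N _) fun _ => e N _⟩

/-! ### The Gamma integral with a complex rate -/

lemma cpow_mul_of_arg_add_mem {x y : ℂ} (hx : x ≠ 0) (hy : y ≠ 0)
    (h : arg x + arg y ∈ Ioc (-Real.pi) Real.pi) (k : ℂ) : (x * y) ^ k = x ^ k * y ^ k := by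
  rw [cpow_def_of_ne_zero (mul_ne_zero hx hy), cpow_def_of_ne_zero hx, cpow_def_of_ne_zero hy,
    log_mul hx hy h, add_mul, exp_add]

lemma ne_zero_of_im_pos {w : ℂ} (hw : 0 < w.im) : w ≠ 0 := by
  rintro rfl; simp at hw

lemma arg_mem_Ioo_of_im_pos {w : ℂ} (hw : 0 < w.im) : arg w ∈ Ioo 0 Real.pi := by
  refine ⟨lt_of_le_of_ne (arg_nonneg_iff.mpr hw.le) fun h => ?_,
    arg_lt_pi_iff.mpr (Or.inr hw.ne')⟩
  exact hw.ne' (arg_eq_zero_iff.mp h.symm).2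

lemma neg_I_mul_cpow {w : ℂ} (hw : 0 < w.im) (k : ℂ) : (-I * w) ^ k = (-I) ^ k * w ^ k := by
  have h := arg_mem_Ioo_of_im_pos hw
  refine cpow_mul_of_arg_add_mem (neg_ne_zero.mpr I_ne_zero) (ne_zero_of_im_pos hw) ?_ k
  rw [arg_neg_I]
  constructor <;> linarith [h.1, h.2, Real.pi_pos]

/-- For two points of the upper half plane the difference of arguments stays in `(-π, π)`. -/
lemma mul_cpow_div {w c : ℂ} (hw : 0 < w.im) (hc : 0 < c.im) (k : ℂ) :
    c ^ k * (w / c) ^ k = w ^ k := by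
  have h1 := arg_mem_Ioo_of_im_pos hw
  have h2 := arg_mem_Ioo_of_im_pos hc
  have hc0 := ne_zero_of_im_pos hc
  have h3 : arg c⁻¹ = - arg c := by rw [arg_inv, if_neg h2.2.ne]
  rw [div_eq_mul_inv, cpow_mul_of_arg_add_mem (ne_zero_of_im_pos hw) (inv_ne_zero hc0),
    inv_cpow _ _ h2.2.ne]
  · have : c ^ k ≠ 0 := by simp [cpow_eq_zero_iff, hc0]
    field_simp
  · rw [h3]
    constructor <;> linarith [h1.1, h1.2, h2.1, h2.2]

lemma integrableOn_cpow_mul_exp {s r : ℂ} (hs : 0 < s.re) (hr : 0 < r.re) :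
    IntegrableOn (fun t : ℝ => (t : ℂ) ^ (s - 1) * exp (-(r * t))) (Ioi 0) := by
  have h1 : IntegrableOn (fun t : ℝ => (t : ℂ) ^ (s - 1) * exp (-((r.re : ℂ) * t))) (Ioi 0) := by
    -- the Bochner integral of a non-integrable function is `0`, but this one is a Gamma value
    refine Integrable.of_integral_ne_zero ?_
    rw [integral_cpow_mul_exp_neg_mul_Ioi hs hr]
    refine mul_ne_zero ?_ (Gamma_ne_zero_of_re_pos hs)
    have : (r.re : ℂ) ≠ 0 := ofReal_ne_zero.mpr hr.ne'
    simp [cpow_eq_zero_iff, this]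
  refine h1.norm.mono' ?_ (ae_of_all _ fun t => ?_)
  · exact (by fun_prop : Measurable
      fun t : ℝ => (t : ℂ) ^ (s - 1) * exp (-(r * t))).aestronglyMeasurable
  · rw [norm_mul, norm_mul, ← neg_mul, ← neg_mul, norm_exp_mul_ofReal, norm_exp_mul_ofReal]
    simp

/-- Both sides are analytic in the rate `r` and agree for real `r`. -/
theorem integral_cpow_mul_exp {s r : ℂ} (hs : 0 < s.re) (hr : 0 < r.re) :
    ∫ t in Ioi (0 : ℝ), (t : ℂ) ^ (s - 1) * exp (-(r * t)) = r ^ (-s) * Gamma s := by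
  have hopen : IsOpen {r : ℂ | 0 < r.re} := isOpen_lt continuous_const continuous_re
  have hf : AnalyticOnNhd ℂ
      (fun r : ℂ => ∫ t in Ioi (0 : ℝ), (t : ℂ) ^ (s - 1) * exp (-(r * t))) {r : ℂ | 0 < r.re} := by
    refine DifferentiableOn.analyticOnNhd (fun r hr => ?_) hopen
    have hr' : 0 < r.re := hr
    have hs1 : 0 < (s + 1).re := by simp; linarith
    have hnhds : {x : ℂ | r.re / 2 < x.re} ∈ 𝓝 r :=
      (isOpen_lt continuous_const continuous_re).mem_nhds (by simp; linarith)
    refine (hasDerivAt_integral_of_dominated_loc_of_deriv_le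
      (F := fun (r : ℂ) (t : ℝ) => (t : ℂ) ^ (s - 1) * exp (-(r * t)))
      (F' := fun (r : ℂ) (t : ℝ) => (t : ℂ) ^ (s - 1) * (exp (-(r * t)) * -(1 * t)))
      (bound := fun t : ℝ => ‖(t : ℂ) ^ (s + 1 - 1) * exp (-(((r.re / 2 : ℝ) : ℂ) * t))‖)
      hnhds (Eventually.of_forall fun x => ?_) (integrableOn_cpow_mul_exp hs hr) ?_ ?_
      (integrableOn_cpow_mul_exp hs1 (by simpa using hr')).norm
      ?_).2.differentiableAt.differentiableWithinAt
    · exact (by fun_prop : Measurable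
        fun t : ℝ => (t : ℂ) ^ (s - 1) * exp (-(x * t))).aestronglyMeasurable
    · exact (by fun_prop : Measurable
        fun t : ℝ => (t : ℂ) ^ (s - 1) * (exp (-(r * t)) * -(1 * t))).aestronglyMeasurable
    · filter_upwards [ae_restrict_mem measurableSet_Ioi] with t ht x hx
      have ht0 : (0 : ℝ) < t := ht
      have e : (t : ℂ) ^ (s + 1 - 1) = (t : ℂ) ^ (s - 1) * t := by
        rw [show s + 1 - 1 = (s - 1) + 1 by ring, cpow_add _ _ (ofReal_ne_zero.mpr ht0.ne'),
          cpow_one]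
      rw [e]
      simp only [norm_mul, norm_neg, one_mul, ← neg_mul, norm_exp_mul_ofReal]
      have hx' : r.re / 2 < x.re := hx
      have h5 : Real.exp ((-x).re * t) ≤ Real.exp ((-((r.re / 2 : ℝ) : ℂ)).re * t) := by
        apply Real.exp_le_exp.mpr
        rw [neg_re, neg_re, ofReal_re]
        nlinarith
      calc ‖(t : ℂ) ^ (s - 1)‖ * (Real.exp ((-x).re * t) * ‖(t : ℂ)‖)
          ≤ ‖(t : ℂ) ^ (s - 1)‖ * (Real.exp ((-((r.re / 2 : ℝ) : ℂ)).re * t) * ‖(t : ℂ)‖) := by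
            gcongr
        _ = _ := by ring
    · refine ae_of_all _ fun t x _ => ?_
      exact (((hasDerivAt_id x).mul_const (t : ℂ)).neg.cexp).const_mul _
  have hg : AnalyticOnNhd ℂ (fun r : ℂ => r ^ (-s) * Gamma s) {r : ℂ | 0 < r.re} := by
    refine DifferentiableOn.analyticOnNhd (fun r hr => ?_) hopen
    exact (((hasDerivAt_id r).cpow_const (Or.inl hr)).mul_const
      _).differentiableAt.differentiableWithinAt
  refine hf.eqOn_of_preconnected_of_frequently_eq hg (convex_halfSpace_re_gt 0).isPreconnected
    (z₀ := 1) (by simp) ?_ hr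
  have hu : Tendsto (fun n : ℕ => ((1 + 1 / ((n : ℝ) + 1) : ℝ) : ℂ)) atTop (𝓝[≠] 1) := by
    refine tendsto_nhdsWithin_iff.mpr ⟨?_, Eventually.of_forall fun n => ?_⟩
    · have h1 := (tendsto_one_div_add_atTop_nhds_zero_nat (𝕜 := ℝ)).const_add 1
      rw [add_zero] at h1
      exact_mod_cast (continuous_ofReal.tendsto 1).comp h1
    · have h2 : (0 : ℝ) < 1 / ((n : ℝ) + 1) := by positivity
      intro h3
      have h4 : (1 + 1 / ((n : ℝ) + 1) : ℝ) = 1 := ofReal_eq_one.mp h3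
      linarith
  refine hu.frequently (Frequently.of_forall fun n => ?_)
  have h2 : (0 : ℝ) < 1 + 1 / ((n : ℝ) + 1) := by positivity
  rw [integral_cpow_mul_exp_neg_mul_Ioi hs h2, one_div, inv_cpow, cpow_neg]
  rw [arg_ofReal_of_nonneg h2.le]
  exact Real.pi_pos.ne

/-- The constant `(-i)^k Γ(-k)` in `integral_cpow_mul_exp_I`. -/
noncomputable def mellinConst (k : ℂ) : ℂ := (-I) ^ k * Gamma (-k)

lemma mellinConst_ne_zero {k : ℂ} (hk : k.re < 0) : mellinConst k ≠ 0 := by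
  refine mul_ne_zero (by simp [cpow_eq_zero_iff]) (Gamma_ne_zero_of_re_pos ?_)
  simpa using hk

lemma integrableOn_cpow_mul_exp_I {k w : ℂ} (hk : k.re < 0) (hw : 0 < w.im) :
    IntegrableOn (fun t : ℝ => (t : ℂ) ^ (-k - 1) * exp (I * w * t)) (Ioi 0) := by
  have := integrableOn_cpow_mul_exp (s := -k) (r := -I * w) (by simpa using hk) (by simpa using hw)
  simpa only [neg_mul, neg_neg] using this

/-- The Mellin representation of `w ^ k` in the upper half plane. -/
lemma integral_cpow_mul_exp_I {k w : ℂ} (hk : k.re < 0) (hw : 0 < w.im) :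
    ∫ t in Ioi (0 : ℝ), (t : ℂ) ^ (-k - 1) * exp (I * w * t) = mellinConst k * w ^ k := by
  have := integral_cpow_mul_exp (s := -k) (r := -I * w) (by simpa using hk) (by simpa using hw)
  rw [neg_neg, neg_I_mul_cpow hw] at this
  simp only [neg_mul, neg_neg] at this
  rw [this, mellinConst]
  ring

/-! ### Weights of negative order in the upper half plane -/

lemma period_im_pos {l : ℂ} (hl : 0 < l.re) : 0 < (period l).im := by
  have h : period l = (2 * Real.pi : ℝ) * (I * l⁻¹) := by rw [period]; push_cast; ring
  rw [h, im_ofReal_mul]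
  have h2 : (I * l⁻¹).im = l.re / normSq l := by simp [inv_re]
  rw [h2]
  have := normSq_pos.mpr (ne_zero_of_re_pos hl)
  have := Real.pi_pos
  positivity

lemma norm_cpow_le_of_im {w k : ℂ} {d : ℝ} (hd : 0 < d) (hw : d ≤ w.im) (hk : k.re ≤ 0) :
    ‖w ^ k‖ ≤ d ^ k.re * Real.exp (Real.pi * |k.im|) := by
  refine (norm_cpow_le_rpow_mul w k).trans ?_
  refine mul_le_mul_of_nonneg_right ?_ (Real.exp_pos _).le
  exact Real.rpow_le_rpow_of_nonpos hd (hw.trans ((le_abs_self _).trans (abs_im_le_norm w))) hk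

lemma aestronglyMeasurable_weight (L k : ℂ) :
    AEStronglyMeasurable (fun u : ℝ => (L + u) ^ k) := by
  exact (by fun_prop : Measurable fun u : ℝ => (L + u) ^ k).aestronglyMeasurable

lemma tempered_of_im_pos {L k : ℂ} (hL : 0 < L.im) (hk : k.re ≤ 0) :
    Tempered fun u => (L + u) ^ k :=
  tempered_of_bounded (aestronglyMeasurable_weight L k)
    fun u => norm_cpow_le_of_im hL (by simp) hk

/-- A purely imaginary character can be absorbed into the exponents of the kernel. -/
lemma integral_kern_mul_exp {l A B : ℂ} (hl : 0 < l.re) (hA : A ∈ strip l) (hB : B ∈ strip l)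
    (t : ℝ) : ∫ u : ℝ, kern l A B u * exp (I * u * t) = period l *
      (exp (period l * A) * exp (I * period l * t) /
        (1 - exp (period l * A) * exp (I * period l * t)) -
      exp (period l * B) * exp (I * period l * t) /
        (1 - exp (period l * B) * exp (I * period l * t))) := by
  have hs : ∀ X ∈ strip l, X + I * t ∈ strip l := by
    intro X hX
    have h1 : (X + I * t).re = X.re := by simp
    exact ⟨h1 ▸ hX.1, h1 ▸ hX.2⟩
  have he : ∀ X, exp (period l * (X + I * t)) = exp (period l * X) * exp (I * period l * t) := by
    intro X
    rw [← exp_add]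
    ring_nf
  rw [← he, ← he, ← integral_kern hl (hs A hA) (hs B hB)]
  congr 1 with u
  have he' : ∀ X : ℂ, exp ((X + I * t) * u) = exp (X * u) * exp (I * u * t) := by
    intro X
    rw [← exp_add]
    ring_nf
  simp only [kern, he']
  ring

/-- For weights of negative order, the Mellin representation of the weight reduces the formula
to `integral_kern`, and the geometric series to the Mellin representation of the coefficients. -/
theorem residueFormula_of_re_neg {l L k : ℂ} (hl : 0 < l.re) (hL : 0 < L.im) (hk : k.re < 0) :
    ResidueFormula l L k := by
  intro A hA B hB hA1 hB1
  refine mul_left_cancel₀ (mellinConst_ne_zero hk) ?_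
  have hθ := period_im_pos hl
  set θ := period l with hθdef
  set zA := exp (θ * A) with hzA
  set zB := exp (θ * B) with hzB
  have hzA1 : ‖zA‖ < 1 := norm_exp_lt_one hA1
  have hzB1 : ‖zB‖ < 1 := norm_exp_lt_one hB1
  set g : ℝ → ℂ := fun t => (t : ℂ) ^ (-k - 1) * exp (I * L * t) with hg
  have hgint : IntegrableOn g (Ioi 0) := integrableOn_cpow_mul_exp_I hk hL
  have hfub : Integrable (Function.uncurry fun (u t : ℝ) =>
      exp (I * u * t) * (kern l A B u * g t)) (volume.prod (volume.restrict (Ioi 0))) := by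
    refine Integrable.bdd_mul (c := 1) ((integrable_kern hl hA hB).mul_prod hgint) ?_
      (ae_of_all _ fun p => ?_)
    · exact (by fun_prop : Continuous
        fun p : ℝ × ℝ => exp (I * p.1 * p.2)).aestronglyMeasurable
    · have : I * (p.1 : ℂ) * p.2 = (p.1 * p.2 : ℝ) * I := by push_cast; ring
      rw [this, norm_exp_ofReal_mul_I]
  have hq : ∀ t : ℝ, 0 < t → ‖exp (I * θ * t)‖ ≤ 1 := by
    intro t ht
    rw [norm_exp_mul_ofReal, Real.exp_le_one_iff]
    have : (I * θ).re = -θ.im := by simp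
    rw [this]
    nlinarith
  have hgeom : ∀ {z q : ℂ}, ‖z‖ < 1 → ‖q‖ ≤ 1 →
      HasSum (fun j : ℕ => z ^ (j + 1) * q ^ (j + 1)) (z * q / (1 - z * q)) := by
    intro z q hz hq
    have hzq : ‖z * q‖ < 1 := by
      rw [norm_mul]
      exact (mul_le_of_le_one_right (norm_nonneg _) hq).trans_lt hz
    have := (hasSum_geometric_of_norm_lt_one hzq).mul_left (z * q)
    rw [← div_eq_mul_inv] at this
    simp only [← mul_pow]
    simpa only [pow_succ'] using this
  -- the integrands of the Mellin representations of the coefficients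
  set F : ℕ → ℝ → ℂ := fun j t => (zA ^ (j + 1) - zB ^ (j + 1)) *
    ((t : ℂ) ^ (-k - 1) * exp (I * (L + θ + θ * j) * t)) with hF
  have him : ∀ j : ℕ, 0 < (L + θ + θ * j).im := by
    intro j
    have : (L + θ + θ * j).im = L.im + θ.im + θ.im * j := by simp
    rw [this]
    positivity
  have hFq : ∀ (j : ℕ) (t : ℝ), F j t =
      g t * (zA ^ (j + 1) * exp (I * θ * t) ^ (j + 1) -
        zB ^ (j + 1) * exp (I * θ * t) ^ (j + 1)) := by
    intro j t
    have : exp (I * (L + θ + θ * j) * t) = exp (I * L * t) * exp (I * θ * t) ^ (j + 1) := by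
      rw [← exp_nat_mul, ← exp_add]
      congr 1
      push_cast
      ring
    simp only [hF, hg, this]
    ring
  have hFint : ∀ j, Integrable (F j) (volume.restrict (Ioi 0)) := fun j =>
    (integrableOn_cpow_mul_exp_I hk (him j)).const_mul _
  have hFsum : Summable fun j => ∫ t in Ioi (0 : ℝ), ‖F j t‖ := by
    refine Summable.of_nonneg_of_le (fun j => integral_nonneg fun t => norm_nonneg _)
      (g := fun j => ∫ t in Ioi (0 : ℝ), ‖F j t‖)
      (f := fun j : ℕ => (‖zA‖ ^ (j + 1) + ‖zB‖ ^ (j + 1)) * ∫ t in Ioi (0 : ℝ), ‖g t‖)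
      (fun j => ?_) ?_
    · rw [← integral_const_mul]
      refine setIntegral_mono_on (hFint j).norm (hgint.norm.const_mul _) measurableSet_Ioi
        fun t ht => ?_
      rw [hFq, ← sub_mul, norm_mul (g t), norm_mul (zA ^ (j + 1) - zB ^ (j + 1)), norm_pow,
        mul_comm]
      gcongr
      calc ‖zA ^ (j + 1) - zB ^ (j + 1)‖ * ‖exp (I * θ * t)‖ ^ (j + 1)
          ≤ ‖zA ^ (j + 1) - zB ^ (j + 1)‖ :=
            mul_le_of_le_one_right (norm_nonneg _) (pow_le_one₀ (norm_nonneg _) (hq t ht))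
        _ ≤ ‖zA ^ (j + 1)‖ + ‖zB ^ (j + 1)‖ := norm_sub_le _ _
        _ = _ := by rw [norm_pow, norm_pow]
    · refine Summable.mul_right _ (Summable.add ?_ ?_)
      · exact (summable_nat_add_iff 1).mpr (summable_geometric_of_lt_one (norm_nonneg _) hzA1)
      · exact (summable_nat_add_iff 1).mpr (summable_geometric_of_lt_one (norm_nonneg _) hzB1)
  have hsum := hasSum_integral_of_summable_integral_norm hFint hFsum
  have hlhs : mellinConst k * ∫ u : ℝ, kern l A B u * (L + u) ^ k =
      θ * ∫ t in Ioi (0 : ℝ), ∑' j, F j t := by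
    rw [← integral_const_mul, ← integral_const_mul]
    calc ∫ u : ℝ, mellinConst k * (kern l A B u * (L + u) ^ k)
        = ∫ u : ℝ, ∫ t in Ioi (0 : ℝ), exp (I * u * t) * (kern l A B u * g t) := by
          congr 1 with u
          rw [mul_left_comm, ← integral_cpow_mul_exp_I hk (by simpa using hL : 0 < (L + u).im),
            ← integral_const_mul]
          congr 1 with t
          have : exp (I * (L + u) * t) = exp (I * L * t) * exp (I * u * t) := by
            rw [← exp_add]; ring_nf
          rw [this]
          simp only [hg]
          ring
      _ = ∫ t in Ioi (0 : ℝ), ∫ u : ℝ, exp (I * u * t) * (kern l A B u * g t) :=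
          integral_integral_swap hfub
      _ = ∫ t in Ioi (0 : ℝ), θ * ∑' j, F j t := by
          refine setIntegral_congr_fun measurableSet_Ioi fun t ht => ?_
          have h1 := ((hgeom hzA1 (hq t ht)).sub (hgeom hzB1 (hq t ht))).mul_left (g t)
          have h2 : ∑' j, F j t = _ := (tsum_congr fun j => hFq j t).trans h1.tsum_eq
          have h3 : ∀ u : ℝ, exp (I * u * t) * (kern l A B u * g t) =
              g t * (kern l A B u * exp (I * u * t)) := fun u => by ring
          simp only [h2, h3]
          rw [integral_const_mul, integral_kern_mul_exp hl hA hB]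
          ring
  rw [hlhs, ← hsum.tsum_eq]
  have hs : ∀ z : ℂ, ‖z‖ < 1 → Summable fun j : ℕ => (L + θ + θ * j) ^ k * z ^ j := fun z hz =>
    (summable_norm_affine (L + θ) k (period_ne_zero hl) hz).of_norm
  have hterm : ∀ j : ℕ, ∫ t in Ioi (0 : ℝ), F j t = mellinConst k *
      (zA * ((L + θ + θ * j) ^ k * zA ^ j) - zB * ((L + θ + θ * j) ^ k * zB ^ j)) := by
    intro j
    simp only [hF]
    rw [integral_const_mul, integral_cpow_mul_exp_I hk (him j)]
    ring
  rw [tsum_congr hterm, tsum_mul_left,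
    ((hs zA hzA1).mul_left zA).tsum_sub ((hs zB hzB1).mul_left zB), tsum_mul_left, tsum_mul_left]
  simp only [affineSeries]
  ring

/-! ### General exponents, and the passage to real `L` -/

lemma cpow_add_one_of_ne {w k : ℂ} (h : w ≠ 0 ∨ k + 1 ≠ 0) : w ^ (k + 1) = w ^ k * w := by
  rcases eq_or_ne w 0 with rfl | hw
  · rw [zero_cpow (h.resolve_left (by simp)), mul_zero]
  · rw [cpow_add _ _ hw, cpow_one]

lemma im_residue_pos {l L : ℂ} (hl : 0 < l.re) (hL : 0 ≤ L.im) (j : ℕ) :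
    0 < (L + period l + period l * j).im := by
  have h := period_im_pos hl
  have : (L + period l + period l * j).im = L.im + (period l).im + (period l).im * j := by simp
  rw [this]
  positivity

/-- For `Im L > 0` no power of `0` occurs, so raising from negative orders reaches every `k`. -/
theorem residueFormula_of_im_pos {l L : ℂ} (hl : 0 < l.re) (hL : 0 < L.im) (k : ℂ) :
    Tempered (fun u => (L + u) ^ k) ∧ ResidueFormula l L k := by
  obtain ⟨n, hn⟩ := exists_nat_gt k.re
  induction n generalizing k with
  | zero =>
    have hk : k.re < 0 := by simpa using hn
    exact ⟨tempered_of_im_pos hL hk.le, residueFormula_of_re_neg hl hL hk⟩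
  | succ n ih =>
    have hn' : (k - 1).re < n := by
      rw [sub_re, one_re]; push_cast at hn; linarith
    obtain ⟨h1, h2⟩ := ih (k - 1) hn'
    have e1 : ∀ u : ℝ, (L + u) ^ (k - 1 + 1) = (L + u) ^ (k - 1) * (L + u) := fun u =>
      cpow_add_one_of_ne (Or.inl (ne_zero_of_im_pos (by simpa using hL)))
    have h3 := h2.add_one hl h1 e1 fun j =>
      cpow_add_one_of_ne (Or.inl (ne_zero_of_im_pos (im_residue_pos hl hL.le j)))
    have h4 := h1.mul_linear L
    simp_rw [← e1] at h4
    rw [sub_add_cancel] at h3 h4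
    exact ⟨h4, h3⟩

/-- The singularity at `u = -x` is integrable since `Re k > -1`; away from it the weight is bounded
since `Re k ≤ 0`. -/
lemma tempered_ofReal (x : ℝ) {k : ℂ} (hk : -1 < k.re) (hk0 : k.re ≤ 0) :
    Tempered fun u => ((x : ℂ) + u) ^ k := by
  intro d hd
  have hloc : IntegrableOn (fun u : ℝ => ((x : ℂ) + u) ^ k) (Ioc (-1 - x) (1 - x)) := by
    have h := (intervalIntegral.intervalIntegrable_cpow' (a := -1) (b := 1) hk).comp_add_right x
    have h' := (intervalIntegrable_iff_integrableOn_Ioc_of_le (by linarith)).mp h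
    refine h'.congr_fun (fun u _ => ?_) measurableSet_Ioc
    push_cast
    rw [add_comm]
  rw [← integrableOn_univ, ← union_compl_self (Ioc (-1 - x) (1 - x))]
  refine IntegrableOn.union ?_ ?_
  · refine hloc.norm.mono' (((aestronglyMeasurable_weight (x : ℂ) k).mul
      (by fun_prop)).restrict) (ae_of_all _ fun u => ?_)
    rw [norm_mul, norm_real, Real.norm_eq_abs, Real.abs_exp]
    exact mul_le_of_le_one_right (norm_nonneg _) (Real.exp_le_one_iff.mpr (by
      rw [Left.neg_nonpos_iff]; positivity))
  · refine ((integrable_exp_neg_mul_abs hd).const_mul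
      (Real.exp (Real.pi * |k.im|))).integrableOn.mono'
      (((aestronglyMeasurable_weight (x : ℂ) k).mul (by fun_prop)).restrict) ?_
    filter_upwards [ae_restrict_mem measurableSet_Ioc.compl] with u hu
    rw [norm_mul, norm_real, Real.norm_eq_abs, Real.abs_exp]
    refine mul_le_mul_of_nonneg_right ?_ (Real.exp_pos _).le
    refine (norm_cpow_le_rpow_mul _ k).trans ?_
    refine mul_le_of_le_one_left (Real.exp_pos _).le (Real.rpow_le_one_of_one_le_of_nonpos ?_ hk0)
    rw [← ofReal_add, norm_real, Real.norm_eq_abs]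
    by_contra hlt
    push Not at hlt
    rw [abs_lt] at hlt
    exact hu ⟨by linarith, by linarith⟩

/-- The principal logarithm, hence every power, is continuous from above on `ℝ \ {0}`. -/
lemma tendsto_cpow_of_im_pos {y : ℝ} (hy : y ≠ 0) {w : ℕ → ℂ} (hw : ∀ n, 0 < (w n).im)
    (hlim : Tendsto w atTop (𝓝 y)) (k : ℂ) :
    Tendsto (fun n => w n ^ k) atTop (𝓝 ((y : ℂ) ^ k)) := by
  have hlog : ContinuousWithinAt log {z : ℂ | 0 ≤ z.im} (y : ℂ) := by
    rcases lt_or_gt_of_ne hy with h | h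
    · exact continuousWithinAt_log_of_re_neg_of_im_zero (by simpa using h) (by simp)
    · exact (continuousAt_clog (Or.inl (by simpa using h))).continuousWithinAt
  have h1 : Tendsto (fun n => log (w n)) atTop (𝓝 (log y)) :=
    hlog.tendsto.comp (tendsto_nhdsWithin_iff.mpr ⟨hlim, Eventually.of_forall fun n => (hw n).le⟩)
  rw [cpow_def_of_ne_zero (ofReal_ne_zero.mpr hy)]
  refine ((continuous_exp.tendsto _).comp (h1.mul_const k)).congr fun n => ?_
  rw [cpow_def_of_ne_zero (ne_zero_of_im_pos (hw n))]
  rfl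

/-- For real `L` and moderate `k`, the formula is the limit of the formulas for `L + iε`. -/
lemma residueFormula_ofReal_of_re_nonpos {l : ℂ} (hl : 0 < l.re) (x : ℝ) {k : ℂ} (hk : -1 < k.re)
    (hk0 : k.re ≤ 0) : ResidueFormula l x k := by
  intro A hA B hB hA1 hB1
  set e : ℕ → ℝ := fun n => 1 / ((n : ℝ) + 1) with he
  have hepos : ∀ n, 0 < e n := fun n => by positivity
  have hlim : ∀ w : ℂ, Tendsto (fun n => w + e n * I) atTop (𝓝 w) := by
    intro w
    have h1 := (continuous_ofReal.tendsto 0).comp tendsto_one_div_add_atTop_nhds_zero_nat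
    have h2 := (h1.mul_const I).const_add w
    rw [ofReal_zero, zero_mul, add_zero] at h2
    exact h2
  have hne : ∀ᵐ u : ℝ, x + u ≠ 0 := by
    have : {u : ℝ | ¬ (x + u ≠ 0)} = {-x} := by
      ext u
      simp only [ne_eq, not_not, mem_ofPred_eq, mem_singleton_iff]
      constructor <;> intro h <;> linarith
    rw [ae_iff, this]
    simp
  have hcomm : ∀ (n : ℕ) (w : ℂ), (x : ℂ) + e n * I + w = x + w + e n * I := fun n w => by ring
  have hT1 : Tendsto (fun n => ∫ u : ℝ, kern l A B u * ((x : ℂ) + e n * I + u) ^ k) atTop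
      (𝓝 (∫ u : ℝ, kern l A B u * ((x : ℂ) + u) ^ k)) := by
    refine tendsto_integral_of_dominated_convergence
      (fun u => Real.exp (Real.pi * |k.im|) * Real.exp (Real.pi * |k.im|) *
        ‖kern l A B u * ((x : ℂ) + u) ^ k‖)
      (fun n => (measurable_kern l A B).aestronglyMeasurable.mul
        (aestronglyMeasurable_weight _ k))
      (((tempered_ofReal x hk hk0).integrable_kern hl hA hB).norm.const_mul _) (fun n => ?_) ?_
    · filter_upwards [hne] with u hu
      have hu' : (x : ℂ) + u ≠ 0 := by exact_mod_cast hu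
      -- `|x + iε + u| ≥ |x + u|` and `Re k ≤ 0`, so the limit weight dominates up to a constant
      have h1 : ‖((x : ℂ) + e n * I + u) ^ k‖ ≤
          ‖(x : ℂ) + u‖ ^ k.re * Real.exp (Real.pi * |k.im|) := by
        refine (norm_cpow_le_rpow_mul _ k).trans ?_
        refine mul_le_mul_of_nonneg_right ?_ (Real.exp_pos _).le
        refine Real.rpow_le_rpow_of_nonpos (norm_pos_iff.mpr hu') ?_ hk0
        have h2 := abs_re_le_norm ((x : ℂ) + e n * I + u)
        rw [← ofReal_add, norm_real, Real.norm_eq_abs]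
        simpa using h2
      have h3 : ‖(x : ℂ) + u‖ ^ k.re ≤
          ‖((x : ℂ) + u) ^ k‖ * Real.exp (Real.pi * |k.im|) := by
        rw [norm_cpow_of_ne_zero hu', div_mul_eq_mul_div, le_div_iff₀ (Real.exp_pos _)]
        refine mul_le_mul_of_nonneg_left (Real.exp_le_exp.mpr ?_)
          (Real.rpow_nonneg (norm_nonneg _) _)
        refine (le_abs_self _).trans ?_
        rw [abs_mul]
        gcongr
        exact abs_arg_le_pi _
      rw [norm_mul, norm_mul]
      calc ‖kern l A B u‖ * ‖((x : ℂ) + e n * I + u) ^ k‖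
          ≤ ‖kern l A B u‖ * ((‖((x : ℂ) + u) ^ k‖ * Real.exp (Real.pi * |k.im|)) *
            Real.exp (Real.pi * |k.im|)) := by
            gcongr
            exact h1.trans (mul_le_mul_of_nonneg_right h3 (Real.exp_pos _).le)
        _ = _ := by ring
    · filter_upwards [hne] with u hu
      refine Tendsto.const_mul _ ?_
      rw [← ofReal_add]
      refine tendsto_cpow_of_im_pos hu (fun n => ?_) ?_ k
      · simpa using hepos n
      · simp_rw [hcomm, ofReal_add]
        exact hlim _
  have hθ := period_im_pos hl
  have hT2 : ∀ z : ℂ, ‖z‖ < 1 → Tendsto (fun n =>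
      affineSeries ((x : ℂ) + e n * I + period l) (period l) k z) atTop
      (𝓝 (affineSeries ((x : ℂ) + period l) (period l) k z)) := by
    intro z hz
    refine tendsto_tsum_of_dominated_convergence
      (bound := fun j => (period l).im ^ k.re * Real.exp (Real.pi * |k.im|) * ‖z‖ ^ j)
      ((summable_geometric_of_lt_one (norm_nonneg _) hz).mul_left _) (fun j => ?_)
      (Eventually.of_forall fun n j => ?_)
    · refine Tendsto.mul_const _ ?_
      have h1 := im_residue_pos hl (L := x) (by simp) j
      have h2 : ContinuousAt (fun w : ℂ => w ^ k) ((x : ℂ) + period l + period l * j) :=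
        continuousAt_cpow_const (Or.inr h1.ne')
      refine h2.tendsto.comp ?_
      refine (hlim _).congr fun n => ?_
      ring
    · rw [norm_mul, norm_pow]
      refine mul_le_mul_of_nonneg_right (norm_cpow_le_of_im hθ ?_ hk0) (by positivity)
      have h3 := hepos n
      have : ((x : ℂ) + e n * I + period l + period l * j).im =
        e n + (period l).im + (period l).im * j := by simp
      rw [this]
      have : 0 ≤ (period l).im * j := by positivity
      linarith
  have hT3 := (((hT2 _ (norm_exp_lt_one hA1)).const_mul (exp (period l * A))).sub
    ((hT2 _ (norm_exp_lt_one hB1)).const_mul (exp (period l * B)))).const_mul (period l)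
  refine tendsto_nhds_unique hT1 (hT3.congr fun n => ?_)
  exact ((residueFormula_of_im_pos hl (L := (x : ℂ) + e n * I) (by simpa using hepos n) k).2
    A hA B hB hA1 hB1).symm

theorem residueFormula_ofReal {l : ℂ} (hl : 0 < l.re) (x : ℝ) {k : ℂ} (hk : -1 < k.re) :
    Tempered (fun u => ((x : ℂ) + u) ^ k) ∧ ResidueFormula l x k := by
  obtain ⟨n, hn⟩ := exists_nat_ge k.re
  induction n generalizing k with
  | zero =>
    have hk0 : k.re ≤ 0 := by simpa using hn
    exact ⟨tempered_ofReal x hk hk0, residueFormula_ofReal_of_re_nonpos hl x hk hk0⟩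
  | succ n ih =>
    rcases le_or_gt k.re 0 with hk0 | hk0
    · exact ⟨tempered_ofReal x hk hk0, residueFormula_ofReal_of_re_nonpos hl x hk hk0⟩
    have hn' : (k - 1).re ≤ n := by
      rw [sub_re, one_re]; push_cast at hn; linarith
    obtain ⟨h1, h2⟩ := ih (k := k - 1) (by rw [sub_re, one_re]; linarith) hn'
    have hk1 : k - 1 + 1 ≠ 0 := by
      rw [sub_add_cancel]
      rintro rfl
      simp at hk0
    have e1 : ∀ w : ℂ, w ^ (k - 1 + 1) = w ^ (k - 1) * w := fun w =>
      cpow_add_one_of_ne (Or.inr hk1)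
    have h3 := h2.add_one hl h1 (fun u => e1 _) fun j => e1 _
    have h4 := h1.mul_linear x
    simp_rw [← e1] at h4
    rw [sub_add_cancel] at h3 h4
    exact ⟨h4, h3⟩

/-! ### Analytic continuation of the Lerch series -/

/-- The series `∑ j, (v + j) ^ k z ^ j` extends analytically from the unit disc to `U`. -/
def Continues (U : Set ℂ) (k v : ℂ) : Prop :=
  ∃ f : ℂ → ℂ, AnalyticOnNhd ℂ f U ∧ ∀ w : ℂ, ‖w‖ < 1 → f w = affineSeries v 1 k w

lemma Continues.add_one {U : Set ℂ} {k v : ℂ} (h : Continues U k v)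
    (h1 : ∀ j : ℕ, (v + j) ^ (k + 1) = (v + j) ^ k * (v + j)) : Continues U (k + 1) v := by
  obtain ⟨f, hf, hfs⟩ := h
  refine ⟨fun z => v * f z + z * deriv f z,
    (analyticOnNhd_const.mul hf).add (analyticOnNhd_id.mul hf.deriv), fun w hw => ?_⟩
  have hev : f =ᶠ[𝓝 w] affineSeries v 1 k := by
    filter_upwards [(isOpen_lt continuous_norm continuous_const).mem_nhds hw] with x hx
    exact hfs x hx
  change v * f w + w * deriv f w = _
  rw [affineSeries_add_one one_ne_zero hw (by simpa using h1), hfs w hw, hev.deriv_eq, one_mul]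

/-- Splitting off the first term of the series. -/
lemma Continues.of_add_one {U : Set ℂ} {k v : ℂ} (h : Continues U k (v + 1)) :
    Continues U k v := by
  obtain ⟨f, hf, hfs⟩ := h
  refine ⟨fun z => v ^ k + z * f z,
    analyticOnNhd_const.add (analyticOnNhd_id.mul hf), fun w hw => ?_⟩
  have h1 := (summable_norm_affine v k one_ne_zero hw).of_norm
  change v ^ k + w * f w = _
  rw [hfs w hw, affineSeries, affineSeries, h1.tsum_eq_zero_add, ← tsum_mul_left]
  congr 1
  · simp
  · refine tsum_congr fun j => ?_
    push_cast
    rw [pow_succ, show v + 1 + 1 * (j : ℂ) = v + 1 * ((j : ℂ) + 1) by ring]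
    ring

/-- For natural `k` the continuation is rational, with `1` as its only pole. -/
lemma continues_natCast (N : ℕ) (v : ℂ) : Continues {1}ᶜ N v := by
  induction N with
  | zero =>
    refine ⟨fun z => (1 - z)⁻¹, fun z hz => ?_, fun w hw => ?_⟩
    · exact (analyticAt_const.sub analyticAt_id).inv (sub_ne_zero.mpr (Ne.symm hz))
    · simp [affineSeries, tsum_geometric_of_norm_lt_one hw]
  | succ N ih =>
    rw [Nat.cast_succ]
    refine ih.add_one fun j => ?_
    rw [← Nat.cast_succ, cpow_natCast, cpow_natCast, pow_succ]

lemma isOpen_lerchDomain : IsOpen lerchDomain :=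
  isOpen_slitPlane.preimage (by fun_prop : Continuous fun w : ℂ => 1 - w)

lemma one_sub_mul_ne_zero {z : ℂ} (hz : z ∈ lerchDomain) {q : ℝ} (hq : q ∈ Icc (0 : ℝ) 1) :
    1 - z * q ≠ 0 := by
  intro h
  have h1 : z * q = 1 := (sub_eq_zero.mp h).symm
  have hq0 : q ≠ 0 := by
    rintro rfl
    simp at h1
  have h2 : z = ((q⁻¹ : ℝ) : ℂ) := by
    rw [ofReal_inv]
    exact eq_inv_of_mul_eq_one_left h1
  have h3 : 1 ≤ q⁻¹ := (one_le_inv₀ (lt_of_le_of_ne hq.1 hq0.symm)).mpr hq.2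
  have h4 : 1 - z ∈ slitPlane := hz
  rw [h2, ← ofReal_one, ← ofReal_sub, ofReal_mem_slitPlane] at h4
  linarith

/-- The denominators `1 - x e^{-t}` are bounded away from `0`, locally uniformly on the cut
plane. -/
lemma exists_lower_bound {z : ℂ} (hz : z ∈ lerchDomain) :
    ∃ s ∈ 𝓝 z, ∃ m : ℝ, 0 < m ∧ ∀ x ∈ s, ∀ q ∈ Icc (0 : ℝ) 1, m ≤ ‖1 - x * q‖ := by
  obtain ⟨ε, hε, hball⟩ := Metric.nhds_basis_closedBall.mem_iff.mp
    (isOpen_lerchDomain.mem_nhds hz)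
  have hcomp : IsCompact (Metric.closedBall z ε ×ˢ Icc (0 : ℝ) 1) :=
    (isCompact_closedBall z ε).prod isCompact_Icc
  obtain ⟨p, hp, hmin⟩ := hcomp.exists_isMinOn
    ⟨(z, 0), Metric.mem_closedBall_self hε.le, by simp⟩
    (f := fun p : ℂ × ℝ => ‖1 - p.1 * p.2‖) (by fun_prop)
  refine ⟨_, Metric.closedBall_mem_nhds z hε, ‖1 - p.1 * p.2‖, ?_, fun x hx q hq => ?_⟩
  · exact norm_pos_iff.mpr (one_sub_mul_ne_zero (hball hp.1) hp.2)
  · exact isMinOn_iff.mp hmin (x, q) ⟨hx, hq⟩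

lemma exp_neg_mem_Icc {t : ℝ} (ht : t ∈ Ioi (0 : ℝ)) : Real.exp (-t) ∈ Icc (0 : ℝ) 1 :=
  ⟨(Real.exp_pos _).le, Real.exp_le_one_iff.mpr (neg_nonpos.mpr (le_of_lt ht))⟩

/-- The Mellin-type integral `Γ(-k)⁻¹ ∫ t ^ (-k-1) e ^ (-vt) / (1 - z e ^ (-t)) dt` makes sense on
the whole cut plane. -/
lemma continues_of_re_neg {k v : ℂ} (hk : k.re < 0) (hv : 0 < v.re) :
    Continues lerchDomain k v := by
  have hs : 0 < (-k).re := by simpa using hk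
  set g : ℝ → ℂ := fun t => (t : ℂ) ^ (-k - 1) * exp (-(v * t)) with hg
  have hgm : Measurable g := by fun_prop
  have hgint : IntegrableOn g (Ioi 0) := integrableOn_cpow_mul_exp hs hv
  set f : ℂ → ℂ := fun z => ∫ t in Ioi (0 : ℝ), g t * (1 - z * (Real.exp (-t) : ℝ))⁻¹ with hf
  have hbound : ∀ {m : ℝ} {z : ℂ}, 0 < m → (∀ q ∈ Icc (0 : ℝ) 1, m ≤ ‖1 - z * q‖) →
      ∀ t ∈ Ioi (0 : ℝ), ‖(1 - z * (Real.exp (-t) : ℝ))⁻¹‖ ≤ m⁻¹ := by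
    intro m z hm hmz t ht
    rw [norm_inv]
    exact inv_anti₀ hm (hmz _ (exp_neg_mem_Icc ht))
  have hmeas : ∀ z : ℂ, Measurable fun t : ℝ => (1 - z * (Real.exp (-t) : ℝ))⁻¹ := by
    intro z
    fun_prop
  have hdiff : DifferentiableOn ℂ f lerchDomain := by
    intro z hz
    obtain ⟨s, hs, m, hm, hms⟩ := exists_lower_bound hz
    have hsz := mem_of_mem_nhds hs
    have hint : IntegrableOn (fun t => g t * (1 - z * (Real.exp (-t) : ℝ))⁻¹) (Ioi 0) := by
      refine (hgint.norm.mul_const m⁻¹).mono' (hgm.mul (hmeas z)).aestronglyMeasurable ?_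
      filter_upwards [ae_restrict_mem measurableSet_Ioi] with t ht
      rw [norm_mul]
      exact mul_le_mul_of_nonneg_left (hbound hm (hms z hsz) t ht) (norm_nonneg _)
    refine (hasDerivAt_integral_of_dominated_loc_of_deriv_le
      (F := fun (z : ℂ) (t : ℝ) => g t * (1 - z * (Real.exp (-t) : ℝ))⁻¹)
      (F' := fun (z : ℂ) (t : ℝ) => g t * ((Real.exp (-t) : ℝ) *
        (1 - z * (Real.exp (-t) : ℝ))⁻¹ ^ 2))
      (bound := fun t : ℝ => ‖g t‖ * m⁻¹ ^ 2)
      hs (Eventually.of_forall fun x => (hgm.mul (hmeas x)).aestronglyMeasurable) hint ?_ ?_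
      (hgint.norm.mul_const _) ?_).2.differentiableAt.differentiableWithinAt
    · exact (hgm.mul (Measurable.mul (by fun_prop) ((hmeas z).pow_const 2))).aestronglyMeasurable
    · filter_upwards [ae_restrict_mem measurableSet_Ioi] with t ht x hx
      rw [norm_mul (g t), norm_mul ((Real.exp (-t) : ℝ) : ℂ), norm_pow]
      refine mul_le_mul_of_nonneg_left ?_ (norm_nonneg _)
      have h1 := hbound hm (hms x hx) t ht
      have h2 : ‖((Real.exp (-t) : ℝ) : ℂ)‖ ≤ 1 := by
        rw [norm_real, Real.norm_eq_abs, Real.abs_exp]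
        exact (exp_neg_mem_Icc ht).2
      calc _ ≤ 1 * m⁻¹ ^ 2 := by gcongr
        _ = _ := one_mul _
    · filter_upwards [ae_restrict_mem measurableSet_Ioi] with t ht x hx
      have hne : 1 - x * (Real.exp (-t) : ℝ) ≠ 0 :=
        norm_pos_iff.mp (hm.trans_le (hms x hx _ (exp_neg_mem_Icc ht)))
      have h1 := ((hasDerivAt_id x).mul_const ((Real.exp (-t) : ℝ) : ℂ)).const_sub 1
      have h2 := (h1.inv hne).const_mul (g t)
      refine h2.congr_deriv ?_
      simp only [id, one_mul, neg_neg, inv_pow, div_eq_mul_inv]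
  refine ⟨fun z => (Gamma (-k))⁻¹ * f z, analyticOnNhd_const.mul
    (hdiff.analyticOnNhd isOpen_lerchDomain), fun z hz => ?_⟩
  have hG := Gamma_ne_zero_of_re_pos hs
  rw [inv_mul_eq_iff_eq_mul₀ hG]
  set F : ℕ → ℝ → ℂ := fun j t =>
    z ^ j * ((t : ℂ) ^ (-k - 1) * exp (-((v + j) * t))) with hF
  have hre : ∀ j : ℕ, 0 < (v + j).re := fun j => by
    rw [add_re, natCast_re]; positivity
  have hFg : ∀ (j : ℕ) (t : ℝ), F j t = g t * (z * (Real.exp (-t) : ℝ)) ^ j := by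
    intro j t
    have : exp (-((v + j) * t)) = exp (-(v * t)) * ((Real.exp (-t) : ℝ) : ℂ) ^ j := by
      rw [ofReal_exp, ← exp_nat_mul, ← exp_add]
      congr 1
      push_cast
      ring
    simp only [hF, hg, this, mul_pow]
    ring
  have hlt : ∀ t ∈ Ioi (0 : ℝ), ‖z * (Real.exp (-t) : ℝ)‖ ≤ ‖z‖ := by
    intro t ht
    rw [norm_mul, norm_real, Real.norm_eq_abs, Real.abs_exp]
    exact mul_le_of_le_one_right (norm_nonneg _) (exp_neg_mem_Icc ht).2
  have hFint : ∀ j, Integrable (F j) (volume.restrict (Ioi 0)) := fun j =>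
    (integrableOn_cpow_mul_exp hs (hre j)).const_mul _
  have hFsum : Summable fun j => ∫ t in Ioi (0 : ℝ), ‖F j t‖ := by
    refine Summable.of_nonneg_of_le (fun j => integral_nonneg fun t => norm_nonneg _)
      (fun j => ?_)
      ((summable_geometric_of_lt_one (norm_nonneg _) hz).mul_right (∫ t in Ioi (0 : ℝ), ‖g t‖))
    rw [← integral_const_mul]
    refine setIntegral_mono_on (hFint j).norm (hgint.norm.const_mul _) measurableSet_Ioi
      fun t ht => ?_
    rw [hFg, norm_mul (g t), norm_pow, mul_comm]
    refine mul_le_mul_of_nonneg_right ?_ (norm_nonneg _)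
    exact pow_le_pow_left₀ (norm_nonneg _) (hlt t ht) j
  have hsum := (hasSum_integral_of_summable_integral_norm hFint hFsum).tsum_eq
  have h1 : f z = ∫ t in Ioi (0 : ℝ), ∑' j, F j t := by
    refine setIntegral_congr_fun measurableSet_Ioi fun t ht => ?_
    simp only [hFg]
    rw [tsum_mul_left, tsum_geometric_of_norm_lt_one ((hlt t ht).trans_lt hz)]
  rw [h1, ← hsum, affineSeries, ← tsum_mul_left]
  refine tsum_congr fun j => ?_
  simp only [hF]
  rw [integral_const_mul, integral_cpow_mul_exp hs (hre j), neg_neg, one_mul]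
  ring

/-- The Lerch series continues to the cut plane for all parameters. -/
theorem continues_lerchDomain (k v : ℂ) : Continues lerchDomain k v := by
  have hpos : ∀ v : ℂ, 0 < v.re → Continues lerchDomain k v := by
    intro v hv
    obtain ⟨n, hn⟩ := exists_nat_gt k.re
    induction n generalizing k with
    | zero => exact continues_of_re_neg (by simpa using hn) hv
    | succ n ih =>
      have h := ih (k - 1) (by rw [sub_re, one_re]; push_cast at hn; linarith)
      have h' := h.add_one fun j => cpow_add_one_of_ne (Or.inl (ne_zero_of_re_pos (by
        rw [add_re, natCast_re]; positivity)))
      rwa [sub_add_cancel] at h'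
  obtain ⟨n, hn⟩ := exists_nat_gt (-v.re)
  induction n generalizing v with
  | zero => exact hpos v (by simp at hn; linarith)
  | succ n ih =>
    refine (ih (v + 1) ?_).of_add_one
    rw [add_re, one_re]; push_cast at hn; linarith

/-! ### Continuation in the exponents -/

lemma period_mul (l X : ℂ) : period l * X = 2 * Real.pi * I * (X / l) := by
  rw [period]; ring

lemma re_period_mul (l X : ℂ) : (period l * X).re = -(2 * Real.pi * (X / l).im) := by
  have : period l * X = (2 * Real.pi : ℝ) * (I * (X / l)) := by
    rw [period_mul]; push_cast; ring
  rw [this, re_ofReal_mul, I_mul_re]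
  ring

/-- Both sides of the residue formula are analytic in each exponent, so the formula extends along
every connected set of exponents which meets the region where the series converge. -/
theorem integral_kern_eq_of_continuation {l L k v : ℂ} (hl : 0 < l.re)
    (hw : Tempered fun u => (L + u) ^ k) (hres : ResidueFormula l L k)
    (hbr : ∀ j : ℕ, (L + period l + period l * j) ^ k = period l ^ k * (v + j) ^ k)
    {Ω : Set ℂ} {f : ℂ → ℂ} (hf : AnalyticOnNhd ℂ f Ω)
    (hfs : ∀ z : ℂ, ‖z‖ < 1 → f z = affineSeries v 1 k z)
    {U : Set ℂ} (hUo : IsOpen U) (hUc : IsPreconnected U) (hUs : U ⊆ strip l)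
    (hUΩ : ∀ X ∈ U, exp (period l * X) ∈ Ω)
    {B₀ : ℂ} (hB₀ : B₀ ∈ U) (hB₀' : (period l * B₀).re < 0)
    {A B : ℂ} (hA : A ∈ U) (hB : B ∈ U) :
    ∫ u : ℝ, kern l A B u * (L + u) ^ k = period l * period l ^ k *
      (exp (period l * A) * f (exp (period l * A)) -
       exp (period l * B) * f (exp (period l * B))) := by
  set Z : ℂ → ℂ := fun X => exp (period l * X) with hZ
  have hZan : ∀ X, AnalyticAt ℂ Z X := fun X => (analyticAt_const.mul analyticAt_id).cexp
  set J : ℂ → ℂ := fun X => ∫ u : ℝ, kern l X B₀ u * (L + u) ^ k with hJ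
  set R : ℂ → ℂ := fun X => period l * period l ^ k * (Z X * f (Z X) - Z B₀ * f (Z B₀)) with hR
  have hseries : ∀ X, (period l * X).re < 0 →
      affineSeries (L + period l) (period l) k (Z X) = period l ^ k * f (Z X) := by
    intro X hX
    rw [hfs _ (norm_exp_lt_one hX), affineSeries, affineSeries, ← tsum_mul_left]
    refine tsum_congr fun j => ?_
    rw [hbr, one_mul, mul_assoc]
  have hJan : AnalyticOnNhd ℂ J U := DifferentiableOn.analyticOnNhd (fun X hX =>
    (hw.hasDerivAt_integral_kern hl (hUs hX)
      (hUs hB₀)).differentiableAt.differentiableWithinAt) hUo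
  have hRan : AnalyticOnNhd ℂ R U := fun X hX =>
    analyticAt_const.mul (((hZan X).mul (AnalyticAt.comp (g := f) (f := Z)
      (hf (Z X) (hUΩ X hX)) (hZan X))).sub analyticAt_const)
  have hev : J =ᶠ[𝓝 B₀] R := by
    have ho : IsOpen {X : ℂ | (period l * X).re < 0} := isOpen_lt (by fun_prop) continuous_const
    filter_upwards [hUo.mem_nhds hB₀, ho.mem_nhds hB₀'] with X hX hX'
    simp only [hJ, hR]
    rw [hres X (hUs hX) B₀ (hUs hB₀) hX' hB₀', hseries X hX', hseries B₀ hB₀']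
    ring
  have hEq := hJan.eqOn_of_preconnected_of_eventuallyEq hRan hUc hB₀ hev
  have hsub : ∫ u : ℝ, kern l A B u * (L + u) ^ k = J A - J B := by
    rw [← integral_sub (hw.integrable_kern hl (hUs hA) (hUs hB₀))
      (hw.integrable_kern hl (hUs hB) (hUs hB₀))]
    congr 1 with u
    simp only [kern]
    ring
  rw [hsub, hEq hA, hEq hB]
  simp only [hR, hZ]
  ring

/-- Every strip contains a point slightly above `l / 2`, where the series converge. -/
lemma exists_base_point {l : ℂ} (hl : 0 < l.re) :
    ∃ B₀ ∈ strip l, 0 < (B₀ / l).im ∧ (B₀ / l).re = 1 / 2 := by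
  have hl0 := ne_zero_of_re_pos hl
  -- small enough that the shift `iεl` changes the real part by at most `Re l / 4`
  set ε : ℝ := l.re / (4 * (|l.im| + 1)) with hε
  have hpos : 0 < ε := by positivity
  have h1 : |ε * l.im| ≤ l.re / 4 := by
    rw [abs_mul, abs_of_pos hpos, hε, div_mul_eq_mul_div,
      div_le_div_iff₀ (by positivity) (by norm_num)]
    nlinarith [abs_nonneg l.im]
  have h2 : ((((1 / 2 : ℝ) : ℂ) + ε * I) * l).re = l.re / 2 - ε * l.im := by
    simp [mul_re]
    ring
  refine ⟨(((1 / 2 : ℝ) : ℂ) + ε * I) * l, ⟨?_, ?_⟩, ?_⟩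
  · rw [h2]; linarith [(abs_le.mp h1).2]
  · rw [h2]; linarith [(abs_le.mp h1).1]
  · rw [mul_div_cancel_right₀ _ hl0]
    simp [hpos]

/-- The exponents in the strip at which the closed form involves the principal branch. -/
def branchStrip (l : ℂ) : Set ℂ :=
  strip l ∩ {X | 0 < (X / l).im} ∪ strip l ∩ {X | 0 < (X / l).re ∧ (X / l).re < 1}

lemma isOpen_branchStrip (l : ℂ) : IsOpen (branchStrip l) := by
  have h1 : Continuous fun X : ℂ => (X / l).im := by fun_prop
  have h2 : Continuous fun X : ℂ => (X / l).re := by fun_prop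
  exact ((isOpen_strip l).inter (isOpen_lt continuous_const h1)).union
    ((isOpen_strip l).inter ((isOpen_lt continuous_const h2).inter (isOpen_lt h2 continuous_const)))

/-- The branch strip is the union of two convex sets with a common point. -/
lemma isPreconnected_branchStrip {l : ℂ} (hl : 0 < l.re) : IsPreconnected (branchStrip l) := by
  obtain ⟨B₀, h1, h2, h3⟩ := exists_base_point hl
  have hlin : IsLinearMap ℝ fun X : ℂ => X / l :=
    ⟨fun x y => add_div x y l, fun c x => by simp [mul_div_assoc]⟩
  refine IsPreconnected.union B₀ ⟨h1, h2⟩ ⟨h1, ?_⟩ ?_ ?_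
  · change 0 < (B₀ / l).re ∧ (B₀ / l).re < 1
    rw [h3]; norm_num
  · exact ((convex_strip l).inter
      ((convex_halfSpace_im_gt 0).is_linear_preimage hlin)).isPreconnected
  · exact ((convex_strip l).inter (((convex_halfSpace_re_gt 0).inter
      (convex_halfSpace_re_lt 1)).is_linear_preimage hlin)).isPreconnected

lemma mem_lerchDomain_of_norm_lt_one {z : ℂ} (hz : ‖z‖ < 1) : z ∈ lerchDomain := by
  left
  rw [sub_re, one_re]
  linarith [re_le_norm z]

lemma exp_mem_lerchDomain {y : ℂ} (h0 : 0 < y.re) (h1 : y.re < 1) :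
    exp (2 * Real.pi * I * y) ∈ lerchDomain := by
  have e : 2 * Real.pi * I * y = ((-(2 * Real.pi * y.im) : ℝ) : ℂ) +
      ((2 * Real.pi * y.re : ℝ) : ℂ) * I := by
    apply Complex.ext <;> simp
  have hre : (exp (2 * Real.pi * I * y)).re =
      Real.exp (-(2 * Real.pi * y.im)) * Real.cos (2 * Real.pi * y.re) := by
    rw [e, exp_re]; simp
  have him : (exp (2 * Real.pi * I * y)).im =
      Real.exp (-(2 * Real.pi * y.im)) * Real.sin (2 * Real.pi * y.re) := by
    rw [e, exp_im]; simp
  by_cases hs : Real.sin (2 * Real.pi * y.re) = 0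
  -- a real value occurs only for `Re y = 1/2`, where it is negative
  · obtain ⟨j, hj⟩ := Real.sin_eq_zero_iff.mp hs
    have h2 : (j : ℝ) = 2 * y.re :=
      mul_right_cancel₀ Real.pi_ne_zero (by rw [hj]; ring)
    have h3 : 0 < j := by exact_mod_cast (by rw [h2]; linarith : (0 : ℝ) < j)
    have h4 : j < 2 := by exact_mod_cast (by rw [h2]; linarith : (j : ℝ) < 2)
    obtain rfl : j = 1 := by omega
    left
    rw [sub_re, one_re, hre, ← hj, Int.cast_one, one_mul, Real.cos_pi]
    have := Real.exp_pos (-(2 * Real.pi * y.im))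
    linarith
  · right
    rw [sub_im, one_im, him, zero_sub, neg_ne_zero]
    exact mul_ne_zero (Real.exp_pos _).ne' hs

lemma exp_period_mul_mem_lerchDomain {l X : ℂ} (hX : X ∈ branchStrip l) :
    exp (period l * X) ∈ lerchDomain := by
  rcases hX with ⟨-, hX⟩ | ⟨-, hX⟩
  · refine mem_lerchDomain_of_norm_lt_one (norm_exp_lt_one ?_)
    rw [re_period_mul, Left.neg_neg_iff]
    exact mul_pos (by positivity) hX
  · rw [period_mul]
    exact exp_mem_lerchDomain hX.1 hX.2

lemma mem_branchStrip {l X n : ℂ} (hX : X ∈ strip l) (hn : 2 * n + 1 = 2 * X)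
    (h : OnPrincipalBranch n l) : X ∈ branchStrip l := by
  have e : (2 * n + 1) / l = (2 : ℝ) * (X / l) := by rw [hn]; push_cast; ring
  rw [OnPrincipalBranch, e, im_ofReal_mul, re_ofReal_mul] at h
  rcases h with h | h
  · exact Or.inl ⟨hX, show 0 < (X / l).im by linarith⟩
  · exact Or.inr ⟨hX, show 0 < (X / l).re ∧ (X / l).re < 1 from
      ⟨by linarith [h.1], by linarith [h.2]⟩⟩

/-! ### The closed form with the Lerch function -/

lemma isLerchContinuation_of_continues {Ω : Set ℂ} {f : ℂ → ℂ} {z k v : ℂ}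
    (hf : AnalyticOnNhd ℂ f Ω) (hfs : ∀ w : ℂ, ‖w‖ < 1 → f w = affineSeries v 1 k w)
    (hΩ : insert z lerchDomain ⊆ Ω) : IsLerchContinuation f z (-k) v :=
  ⟨hf.mono hΩ, fun w hw => by rw [hfs w hw, lerchSeries_eq_affineSeries, neg_neg]⟩

/-- The points `L + θ (j + 1)` are the multiples `θ (v + j)` of the terms of the Lerch series. -/
lemma lerch_argument {l : ℂ} (hl : 0 < l.re) (L : ℂ) (j : ℕ) :
    L + period l + period l * j = period l * (1 - I * l * L / (2 * Real.pi) + j) := by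
  have hl0 := ne_zero_of_re_pos hl
  have hpi : (Real.pi : ℂ) ≠ 0 := ofReal_ne_zero.mpr Real.pi_ne_zero
  rw [period]
  field_simp
  linear_combination (L * l) * I_sq

/-- The closed form on the real line.  For natural `k` the continuation is rational and the whole
strip is available; otherwise the exponents stay in the part of it mapped into the cut plane. -/
theorem integral_kern_eq_lerchPhi {l L k A B : ℂ} (hl : 0 < l.re)
    (hA : A ∈ strip l) (hB : B ∈ strip l)
    (h : (∃ N : ℕ, k = (N : ℂ)) ∨ ((0 < L.im ∨ (L.im = 0 ∧ -1 < k.re)) ∧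
      A ∈ branchStrip l ∧ B ∈ branchStrip l)) :
    Tempered (fun u => (L + u) ^ k) ∧
    ∫ u : ℝ, kern l A B u * (L + u) ^ k = period l * period l ^ k *
      (exp (period l * A) * lerchPhi (exp (period l * A)) (-k)
          (1 - I * l * L / (2 * Real.pi)) -
       exp (period l * B) * lerchPhi (exp (period l * B)) (-k)
          (1 - I * l * L / (2 * Real.pi))) := by
  obtain ⟨B₀, hB₀, hB₀1, hB₀2⟩ := exists_base_point hl
  have hB₀' : (period l * B₀).re < 0 := by
    rw [re_period_mul, Left.neg_neg_iff]
    exact mul_pos (by positivity) hB₀1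
  have hA1 := exp_period_mul_ne_one hl hA
  have hB1 := exp_period_mul_ne_one hl hB
  rcases h with ⟨N, rfl⟩ | ⟨hL, hA', hB'⟩
  · obtain ⟨hw, hres⟩ := residueFormula_natCast hl L N
    obtain ⟨f, hf, hfs⟩ := continues_natCast N (1 - I * l * L / (2 * Real.pi))
    have hsub : ∀ z : ℂ, z ≠ 1 → insert z lerchDomain ⊆ ({1}ᶜ : Set ℂ) := by
      intro z hz
      refine insert_subset hz fun w hw h1 => ?_
      rw [mem_singleton_iff.mp h1] at hw
      simp [lerchDomain] at hw
    refine ⟨hw, ?_⟩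
    rw [(isLerchContinuation_of_continues hf hfs (hsub _ hA1)).lerchPhi_eq hA1,
      (isLerchContinuation_of_continues hf hfs (hsub _ hB1)).lerchPhi_eq hB1]
    refine integral_kern_eq_of_continuation hl hw hres (fun j => ?_) hf hfs (isOpen_strip l)
      (convex_strip l).isPreconnected subset_rfl (fun X hX => exp_period_mul_ne_one hl hX)
      hB₀ hB₀' hA hB
    rw [lerch_argument hl, cpow_natCast, cpow_natCast, cpow_natCast, mul_pow]
  · have hLim : 0 ≤ L.im := by
      rcases hL with h | h
      · exact h.le
      · exact h.1.ge
    obtain ⟨hw, hres⟩ : Tempered (fun u => (L + u) ^ k) ∧ ResidueFormula l L k := by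
      rcases hL with h | ⟨h, hk⟩
      · exact residueFormula_of_im_pos hl h k
      · obtain ⟨x, rfl⟩ : ∃ x : ℝ, L = x := ⟨L.re, Complex.ext (by simp) (by simpa using h)⟩
        exact residueFormula_ofReal hl x hk
    obtain ⟨f, hf, hfs⟩ := continues_lerchDomain k (1 - I * l * L / (2 * Real.pi))
    have hsub : ∀ X ∈ branchStrip l, insert (exp (period l * X)) lerchDomain ⊆ lerchDomain :=
      fun X hX => insert_subset (exp_period_mul_mem_lerchDomain hX) subset_rfl
    refine ⟨hw, ?_⟩
    rw [(isLerchContinuation_of_continues hf hfs (hsub A hA')).lerchPhi_eq hA1,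
      (isLerchContinuation_of_continues hf hfs (hsub B hB')).lerchPhi_eq hB1]
    refine integral_kern_eq_of_continuation hl hw hres (fun j => ?_) hf hfs
      (isOpen_branchStrip l) (isPreconnected_branchStrip hl)
      (union_subset inter_subset_left inter_subset_left)
      (fun X hX => exp_period_mul_mem_lerchDomain hX) (Or.inl ⟨hB₀, hB₀1⟩) hB₀' hA' hB'
    -- the residue and the spacing both lie in the upper half plane, so no branch cut interferes
    rw [← mul_cpow_div (im_residue_pos hl hLim j) (period_im_pos hl), lerch_argument hl,
      mul_div_cancel_left₀ _ (period_ne_zero hl)]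

/-! ### The substitution `x = e^{u/2}` -/

lemma ofReal_exp_cpow (y : ℝ) (c : ℂ) : (Real.exp y : ℂ) ^ c = exp (y * c) := by
  rw [cpow_def_of_ne_zero (ofReal_ne_zero.mpr (Real.exp_pos y).ne'), ← ofReal_log
    (Real.exp_pos y).le, Real.log_exp]

/-- The integrand times the Jacobian of `x = e^{u/2}`; the latter accounts for the shift by `1/2` in
the exponents. -/
lemma substitution_exp_half {a : ℂ} (ha : a ≠ 0) (m n k l : ℂ) (u : ℝ) :
    |Real.exp (u / 2) * (1 / 2)| • (((Real.exp (u / 2) : ℝ) : ℂ) ^ (2 * n) -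
        ((Real.exp (u / 2) : ℝ) : ℂ) ^ (2 * m)) *
      log (a * ((Real.exp (u / 2) : ℝ) : ℂ) ^ 2) ^ k /
        (((Real.exp (u / 2) : ℝ) : ℂ) ^ (2 * l) - 1) =
    1 / 2 * (kern l (n + 1 / 2) (m + 1 / 2) u * (log a + u) ^ k) := by
  have h1 : ((Real.exp (u / 2) : ℝ) : ℂ) ^ 2 = (Real.exp u : ℝ) := by
    rw [← ofReal_pow, ← Real.exp_nat_mul]
    congr 2
    push_cast
    ring
  have h2 : ∀ c : ℂ, exp ((c + 1 / 2) * u) = (Real.exp (u / 2) : ℝ) *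
      exp (((u / 2 : ℝ) : ℂ) * (2 * c)) := by
    intro c
    rw [ofReal_exp, ← exp_add]
    congr 1
    push_cast
    ring
  have h3 : exp (((u / 2 : ℝ) : ℂ) * (2 * l)) = exp (l * u) := by
    congr 1
    push_cast
    ring
  rw [h1, log_mul_ofReal _ (Real.exp_pos u) _ ha, Real.log_exp, abs_of_pos (by positivity),
    real_smul, ofReal_exp_cpow, ofReal_exp_cpow, ofReal_exp_cpow, kern, h2, h2, h3,
    add_comm (u : ℂ)]
  push_cast
  ring

lemma image_exp_half : (fun u : ℝ => Real.exp (u / 2)) '' univ = Ioi 0 := by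
  ext x
  constructor
  · rintro ⟨u, -, rfl⟩
    exact Real.exp_pos _
  · intro hx
    exact ⟨2 * Real.log x, mem_univ _, by simp [Real.exp_log hx]⟩

lemma hasDerivWithinAt_exp_half (u : ℝ) :
    HasDerivWithinAt (fun u : ℝ => Real.exp (u / 2)) (Real.exp (u / 2) * (1 / 2)) univ u :=
  (((hasDerivAt_id u).div_const 2).exp).hasDerivWithinAt

lemma injOn_exp_half : InjOn (fun u : ℝ => Real.exp (u / 2)) univ := by
  intro x _ y _ h
  have := Real.exp_injective h
  linarith

lemma period_cpow {l : ℂ} (hl : 0 < l.re) (k : ℂ) :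
    period l ^ k = 2 ^ k * (Real.pi : ℂ) ^ k * (I / l) ^ k := by
  have h1 : period l = ((2 * Real.pi : ℝ) : ℂ) * (I / l) := by
    rw [period]; push_cast; ring
  have h2 : (0 : ℝ) < 2 * Real.pi := by positivity
  have h3 : arg ((2 * Real.pi : ℝ) : ℂ) = 0 := arg_ofReal_of_nonneg h2.le
  rw [h1, cpow_mul_of_arg_add_mem (ofReal_ne_zero.mpr h2.ne')
    (div_ne_zero I_ne_zero (ne_zero_of_re_pos hl)) (by rw [h3, zero_add]; exact arg_mem_Ioc _),
    ofReal_mul, mul_cpow_ofReal_nonneg (by norm_num) Real.pi_pos.le]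
  norm_num

end LerchIntegral

open LerchIntegral Complex MeasureTheory Set in
theorem mainTheorem1 (m n a k l : ℂ)
    (hl : 0 < l.re)
    (hn₀ : 0 < (2 * n + 1).re) (hn₁ : (2 * n + 1).re < 2 * l.re)
    (hm₀ : 0 < (2 * m + 1).re) (hm₁ : (2 * m + 1).re < 2 * l.re)
    (ha : a ≠ 0)
    (hbranch : (∃ N : ℕ, k = (N : ℂ)) ∨
      ((0 < a.arg ∨ (a.arg = 0 ∧ -1 < k.re)) ∧
        OnPrincipalBranch n l ∧ OnPrincipalBranch m l)) :
    MeasureTheory.IntegrableOn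
      (fun x : ℝ => ((x : ℂ) ^ (2 * n) - (x : ℂ) ^ (2 * m)) *
        Complex.log (a * (x : ℂ) ^ 2) ^ k / ((x : ℂ) ^ (2 * l) - 1)) (Set.Ioi 0) ∧
    ∫ x in Set.Ioi (0 : ℝ), ((x : ℂ) ^ (2 * n) - (x : ℂ) ^ (2 * m)) *
        Complex.log (a * (x : ℂ) ^ 2) ^ k / ((x : ℂ) ^ (2 * l) - 1) =
      Complex.I * 2 ^ k * (Real.pi : ℂ) ^ (k + 1) * (Complex.I / l) ^ k *
          Complex.exp (Complex.I * (2 * Real.pi * n + Real.pi) / l) *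
          lerchPhi (Complex.exp (Complex.I * (2 * n + 1) * Real.pi / l)) (-k)
            (1 - Complex.I * l * Complex.log a / (2 * Real.pi)) / l -
      Complex.I * 2 ^ k * (Real.pi : ℂ) ^ (k + 1) * (Complex.I / l) ^ k *
          Complex.exp (Complex.I * (2 * Real.pi * m + Real.pi) / l) *
          lerchPhi (Complex.exp (Complex.I * (2 * m + 1) * Real.pi / l)) (-k)
            (1 - Complex.I * l * Complex.log a / (2 * Real.pi)) / l := by
  have hstrip : ∀ p : ℂ, 0 < (2 * p + 1).re → (2 * p + 1).re < 2 * l.re → p + 1 / 2 ∈ strip l := by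
    intro p h0 h1
    have e : (2 * p + 1).re = 2 * (p + 1 / 2).re := by
      rw [← re_ofReal_mul]
      congr 1
      push_cast
      ring
    rw [e] at h0 h1
    exact ⟨by linarith, by linarith⟩
  have hA := hstrip n hn₀ hn₁
  have hB := hstrip m hm₀ hm₁
  obtain ⟨hw, hval⟩ := integral_kern_eq_lerchPhi (L := log a) (k := k) hl hA hB (by
    rw [log_im]
    refine hbranch.imp_right fun h => ⟨h.1, ?_, ?_⟩
    · exact mem_branchStrip hA (by ring) h.2.1
    · exact mem_branchStrip hB (by ring) h.2.2)
  have hsmul : ∀ (r : ℝ) (x y z : ℂ), r • (x * y / z) = r • x * y / z := by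
    intro r x y z
    simp only [real_smul]
    ring
  constructor
  · rw [← image_exp_half, integrableOn_image_iff_integrableOn_abs_deriv_smul MeasurableSet.univ
      (fun u _ => hasDerivWithinAt_exp_half u) injOn_exp_half, integrableOn_univ]
    simp_rw [hsmul, substitution_exp_half ha]
    exact (hw.integrable_kern hl hA hB).const_mul _
  · rw [← image_exp_half, integral_image_eq_integral_abs_deriv_smul MeasurableSet.univ
      (fun u _ => hasDerivWithinAt_exp_half u) injOn_exp_half, setIntegral_univ]
    simp_rw [hsmul, substitution_exp_half ha]
    rw [integral_const_mul, hval]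
    have e1 : ∀ p : ℂ, I * (2 * p + 1) * Real.pi / l = period l * (p + 1 / 2) := by
      intro p; rw [period]; ring
    have e2 : ∀ p : ℂ, I * (2 * Real.pi * p + Real.pi) / l = period l * (p + 1 / 2) := by
      intro p; rw [period]; ring
    rw [e1, e1, e2, e2, cpow_add _ _ (ofReal_ne_zero.mpr Real.pi_ne_zero), cpow_one,
      period_cpow hl]
    -- `period l / 2 = iπ / l` is the remaining prefactor
    have e3 : 1 / 2 * period l = I * Real.pi / l := by rw [period]; ring
    linear_combination (2 ^ k * (Real.pi : ℂ) ^ k * (I / l) ^ k *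
      (exp (period l * (n + 1 / 2)) * lerchPhi (exp (period l * (n + 1 / 2))) (-k)
          (1 - I * l * log a / (2 * Real.pi)) -
       exp (period l * (m + 1 / 2)) * lerchPhi (exp (period l * (m + 1 / 2))) (-k)
          (1 - I * l * log a / (2 * Real.pi)))) * e3
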